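/- **Setting.** Let $N$ be a number of layers. Layer $n$ has an optimal low-rank update $W_n=B^\star(n)A^\star(n)$ with $A^\star(n)\in\mathbb R^{r\times d}$, $B^\star(n)\in\mathbb R^{d\times r}$, an input matrix $X_n\in\mathbb R^{d\times m}$, and the reconstruction loss $\ell_n(A,B)=\tfrac12\|W_nX_n-BAX_n\|_F^2$. The inputs $X_n$ and the initial factors $A^0(n)\in\mathbb R^{r\times d}$, $B^0(n)\in\mathbb R^{d\times r}$ may be random. Put $\delta^t(n)=\|W_n(I-A^t(n)^\dagger A^t(n))\|_F$, where $\dagger$ is the Moore–Penrose pseudoinverse, and $\mathcal R_{\rm rec}(\mathbf W)=\frac1N\sum_{n=1}^N\|W_nX_n-B(n)A(n)X_n\|_F^2$. *AS-LoRA* with step size $\eta$: in round $t$ and layer $n$, for $a\in\{A,B\}$ let $g_a=\nabla_a\ell_n$ and $H_a=\nabla_a^2\ell_n$ at $(A^t(n),B^t(n))$; a block $a$ maximizing $S_a=\|g_a\|_F^2-\frac\eta2\langle g_a,H_ag_a\rangle$ is activated (ties are broken arbitrarily but measurably) and replaced by $a-\eta g_a$, and the other block is kept. *FFA-LoRA*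 starts from the same initialization, keeps $A^0(n)$ and makes the step $B\leftarrow B-\eta\nabla_B\ell_n(A^0(n),B)$ in every round. **Assumptions.** Let $\mu,\beta,\kappa,s_-,s_+,w>0$ and $0<\eta\le1/\beta$. Almost surely, in all layers: - along the AS-LoRA trajectory, $\mu I\preceq H_a\preceq\beta I$ for both blocks $a\in\{A,B\}$ (the lower bound on $H_A$ is not required at $t=0$, so that $B^0=0$ is allowed); - the inputs are well conditioned: $\sigma_{\max}(X_n)\le\kappa\,\sigma_{\min}^+(X_n^\top A^0(n)^\dagger)$ and $s_-\le\sigma_{\max}(X_n)\le s_+$, where $\sigma^+_{\min}$ is the smallest nonzero singular value; - $\|W_n\|_{\rm op}\le w$; - the block $A$ of layer $n$ is activated in $\Theta(T)$ of the first $T$ rounds. **Conclusion.** There are constants $c_1,c_2>0$ depending only on $(\mu,\beta,\kappa,s_-,s_+)$, and constants $C>0$, $\rho\in(0,1)$ and round numbers $T(\varepsilon)=O(\log(1/\varepsilon))$ as $\varepsilon\to0^+$ depending only on these and on $(\eta,w,r)$, such that: 1. almost surely $\delta^t(n)\le C\rho^t$ for all $t$ and $n$; 2. for every $\varepsilon>0$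 and every $t\ge T(\varepsilon)$, almost surely $\delta^t(n)\le\varepsilon$ for all $n$, and $\mathbb E[\mathcal R_{\rm rec}(\mathbf W_t^{\rm AS})]\le c_2\varepsilon^2$; 3. the risks of both methods in every round and the $\delta^0(n)^2$ are integrable, the limits $R_{\rm AS}=\lim_{T\to\infty}\mathbb E[\mathcal R_{\rm rec}(\mathbf W_T^{\rm AS})]$ and $R_{\rm FFA}=\lim_{T\to\infty}\mathbb E[\mathcal R_{\rm rec}(\mathbf W_T^{\rm FFA})]$ exist, $R_{\rm AS}\le c_2\varepsilon^2$ for every $\varepsilon>0$, and $$c_1\,\frac1N\sum_{n=1}^N\mathbb E[\delta^0(n)^2]\;\le\;R_{\rm FFA}\;\le\;c_2\,\frac1N\sum_{n=1}^N\mathbb E[\delta^0(n)^2];$$ 4. $R_{\rm AS}<R_{\rm FFA}$ whenever, for some $\varepsilon>0$ and some layer $n_0$, $\delta^0(n_0)>\varepsilon$ with positive probability (for a deterministic initialization: whenever $\delta^0(n_0)>\varepsilon$). -/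

import Mathlib

open MeasureTheory ProbabilityTheory Filter Topology Asymptotics
open scoped Matrix

namespace ASLoRA

noncomputable section

/-! ## Matrix notions: Frobenius norm, singular values, Moore-Penrose pseudoinverse -/

/-- Frobenius inner product `tr(Mᵀ N)`. -/
def frobInner {p q : ℕ} (M N : Matrix (Fin p) (Fin q) ℝ) : ℝ := (Mᵀ * N).trace

/-- Squared Frobenius norm. -/
def frobSq {p q : ℕ} (M : Matrix (Fin p) (Fin q) ℝ) : ℝ := ∑ i, ∑ j, M i j ^ 2

/-- Frobenius norm. -/
def frobNorm {p q : ℕ} (M : Matrix (Fin p) (Fin q) ℝ) : ℝ := √(frobSq M)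

/-- Largest singular value (operator norm for the Euclidean norms). -/
def sigmaMax {p q : ℕ} (M : Matrix (Fin p) (Fin q) ℝ) : ℝ :=
  (Matrix.toEuclideanLin M).singularValues 0

/-- Smallest nonzero singular value: Mathlib lists the singular values in decreasing order from
index `0`, and exactly the first `rank M` of them are nonzero (the value is `0` if `M = 0`). -/
def sigmaMinPos {p q : ℕ} (M : Matrix (Fin p) (Fin q) ℝ) : ℝ :=
  (Matrix.toEuclideanLin M).singularValues (M.rank - 1)

/-- Moore-Penrose pseudoinverse `M† = (Mᵀ M)† Mᵀ`, where the symmetric matrix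
`Mᵀ M = U diag(λ) Uᵀ` has the pseudoinverse `U diag(λ⁻¹) Uᵀ` with the convention `0⁻¹ = 0`.
The Penrose conditions and uniqueness are proved below. -/
def pinv {p q : ℕ} (M : Matrix (Fin p) (Fin q) ℝ) : Matrix (Fin q) (Fin p) ℝ :=
  let h : (Mᵀ * M).IsHermitian := Matrix.isHermitian_conjTranspose_mul_self M
  (h.eigenvectorUnitary : Matrix (Fin q) (Fin q) ℝ) *
    Matrix.diagonal (fun i => (h.eigenvalues i)⁻¹) *
    (h.eigenvectorUnitary : Matrix (Fin q) (Fin q) ℝ)ᵀ * Mᵀ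

/-- The four Penrose conditions. -/
structure IsPenroseInverse {p q : ℕ} (M : Matrix (Fin p) (Fin q) ℝ)
    (N : Matrix (Fin q) (Fin p) ℝ) : Prop where
  mul_mul : M * N * M = M
  mul_mul' : N * M * N = N
  symm_left : (M * N)ᵀ = M * N
  symm_right : (N * M)ᵀ = N * M

theorem isPenroseInverse_pinv {p q : ℕ} (M : Matrix (Fin p) (Fin q) ℝ) :
    IsPenroseInverse M (pinv M) := by
  have h : (Mᵀ * M).IsHermitian := Matrix.isHermitian_conjTranspose_mul_self M
  obtain ⟨U, D, D', hUU, hS, hp, hDt', hDD, hD1, hD2⟩ :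
      ∃ U D D' : Matrix (Fin q) (Fin q) ℝ, Uᵀ * U = 1 ∧ Mᵀ * M = U * D * Uᵀ ∧
        pinv M = U * D' * Uᵀ * Mᵀ ∧ D'ᵀ = D' ∧ (D' * D)ᵀ = D' * D ∧
        D' * D * D' = D' ∧ D * (D' * D) = D := by
    refine ⟨h.eigenvectorUnitary, Matrix.diagonal h.eigenvalues,
      Matrix.diagonal (fun i => (h.eigenvalues i)⁻¹), ?_, ?_, rfl, by simp, by simp, ?_, ?_⟩
    · have := Unitary.coe_star_mul_self h.eigenvectorUnitary
      rwa [Matrix.star_eq_conjTranspose, Matrix.conjTranspose_eq_transpose_of_trivial] at this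
    · have := h.spectral_theorem
      rw [Unitary.conjStarAlgAut_apply, Matrix.star_eq_conjTranspose,
        Matrix.conjTranspose_eq_transpose_of_trivial] at this
      exact this
    · simp only [Matrix.diagonal_mul_diagonal]
      congr 1; ext i
      by_cases hi : h.eigenvalues i = 0 <;> simp [hi]
    · simp only [Matrix.diagonal_mul_diagonal]
      congr 1; ext i
      by_cases hi : h.eigenvalues i = 0 <;> simp [hi]
  have cancel : ∀ Y Z : Matrix (Fin q) (Fin q) ℝ, U * Y * Uᵀ * (U * Z * Uᵀ) = U * (Y * Z) * Uᵀ := by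
    intro Y Z
    calc U * Y * Uᵀ * (U * Z * Uᵀ) = U * Y * (Uᵀ * U) * Z * Uᵀ := by simp only [Matrix.mul_assoc]
      _ = _ := by rw [hUU]; simp only [Matrix.mul_assoc, Matrix.mul_one]
  have hNM : pinv M * M = U * (D' * D) * Uᵀ := by
    rw [hp, Matrix.mul_assoc _ Mᵀ M, hS, cancel]
  have hz : M * (1 - pinv M * M) = 0 := by
    rw [← Matrix.conjTranspose_mul_self_eq_zero, Matrix.conjTranspose_mul, Matrix.mul_assoc,
      ← Matrix.mul_assoc Mᴴ, Matrix.conjTranspose_eq_transpose_of_trivial M, hS, Matrix.mul_sub,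
      hNM, cancel, hD2]
    simp
  refine ⟨?_, ?_, ?_, ?_⟩
  · rw [Matrix.mul_sub, Matrix.mul_one, sub_eq_zero, ← Matrix.mul_assoc] at hz
    exact hz.symm
  · rw [hNM, hp, ← Matrix.mul_assoc, cancel, hD1]
  · rw [hp]
    simp only [Matrix.transpose_mul, Matrix.transpose_transpose, hDt', Matrix.mul_assoc]
  · rw [hNM, Matrix.transpose_mul, Matrix.transpose_mul, Matrix.transpose_transpose, hDD,
      ← Matrix.mul_assoc U]

theorem IsPenroseInverse.unique {p q : ℕ} {M : Matrix (Fin p) (Fin q) ℝ}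
    {N N' : Matrix (Fin q) (Fin p) ℝ} (h : IsPenroseInverse M N) (h' : IsPenroseInverse M N') :
    N = N' := by
  have e1 : M * N = M * N' := by
    have : (M * N)ᵀ = (M * N' * (M * N))ᵀ := by
      rw [← Matrix.mul_assoc, h'.mul_mul]
    rw [h.symm_left, Matrix.transpose_mul, h.symm_left, h'.symm_left, ← Matrix.mul_assoc,
      h.mul_mul] at this
    exact this
  have e2 : N * M = N' * M := by
    have : (N * M)ᵀ = (N * M * (N' * M))ᵀ := by
      rw [Matrix.mul_assoc, ← Matrix.mul_assoc M, h'.mul_mul]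
    rw [h.symm_right, Matrix.transpose_mul, h.symm_right, h'.symm_right, Matrix.mul_assoc,
      ← Matrix.mul_assoc M, h.mul_mul] at this
    exact this
  rw [← h.mul_mul', e2, Matrix.mul_assoc, e1, ← Matrix.mul_assoc, h'.mul_mul']

/-! ## One layer: reconstruction loss, block gradients, block Hessians, scores, misalignment -/

/-- Layer reconstruction loss `½ ‖W X - B A X‖_F²`, where `W = B⋆ A⋆` is the optimal update. -/
def layerLoss {d r m : ℕ} (W : Matrix (Fin d) (Fin d) ℝ) (X : Matrix (Fin d) (Fin m) ℝ)
    (A : Matrix (Fin r) (Fin d) ℝ) (B : Matrix (Fin d) (Fin r) ℝ) : ℝ :=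
  1 / 2 * frobSq (W * X - B * A * X)

/-- Gradient of the layer loss in the block `A`. -/
def gradA {d r m : ℕ} (W : Matrix (Fin d) (Fin d) ℝ) (X : Matrix (Fin d) (Fin m) ℝ)
    (A : Matrix (Fin r) (Fin d) ℝ) (B : Matrix (Fin d) (Fin r) ℝ) : Matrix (Fin r) (Fin d) ℝ :=
  Bᵀ * (B * A * X - W * X) * Xᵀ

/-- Gradient of the layer loss in the block `B`. -/
def gradB {d r m : ℕ} (W : Matrix (Fin d) (Fin d) ℝ) (X : Matrix (Fin d) (Fin m) ℝ)
    (A : Matrix (Fin r) (Fin d) ℝ) (B : Matrix (Fin d) (Fin r) ℝ) : Matrix (Fin d) (Fin r) ℝ :=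
  (B * A * X - W * X) * (A * X)ᵀ

/-- Hessian of the layer loss in the block `A`, as an operator on directions `D`. -/
def hessA {d r m : ℕ} (X : Matrix (Fin d) (Fin m) ℝ) (B : Matrix (Fin d) (Fin r) ℝ)
    (D : Matrix (Fin r) (Fin d) ℝ) : Matrix (Fin r) (Fin d) ℝ :=
  Bᵀ * (B * D * X) * Xᵀ

/-- Hessian of the layer loss in the block `B`, as an operator on directions `D`. -/
def hessB {d r m : ℕ} (X : Matrix (Fin d) (Fin m) ℝ) (A : Matrix (Fin r) (Fin d) ℝ)
    (D : Matrix (Fin d) (Fin r) ℝ) : Matrix (Fin d) (Fin r) ℝ :=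
  D * A * X * (A * X)ᵀ

theorem frobSq_eq_frobInner {p q : ℕ} (M : Matrix (Fin p) (Fin q) ℝ) :
    frobSq M = frobInner M M := by
  simp only [frobSq, frobInner, Matrix.trace, Matrix.diag, Matrix.mul_apply,
    Matrix.transpose_apply, pow_two]
  exact Finset.sum_comm

theorem frobSq_sub {p q : ℕ} (M N : Matrix (Fin p) (Fin q) ℝ) :
    frobSq (M - N) = frobSq M - 2 * frobInner M N + frobSq N := by
  have hc : frobInner N M = frobInner M N := by
    unfold frobInner
    rw [← Matrix.trace_transpose, Matrix.transpose_mul, Matrix.transpose_transpose]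
  simp only [frobSq_eq_frobInner]
  unfold frobInner at *
  simp only [Matrix.transpose_sub, Matrix.sub_mul, Matrix.mul_sub, Matrix.trace_sub, hc]
  ring

/-- The loss is exactly quadratic in `A`, with gradient `gradA` and Hessian `hessA`. -/
theorem layerLoss_add_A {d r m : ℕ} (W : Matrix (Fin d) (Fin d) ℝ) (X : Matrix (Fin d) (Fin m) ℝ)
    (A D : Matrix (Fin r) (Fin d) ℝ) (B : Matrix (Fin d) (Fin r) ℝ) :
    layerLoss W X (A + D) B = layerLoss W X A B + frobInner (gradA W X A B) D +
      1 / 2 * frobInner D (hessA X B D) := by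
  have e : W * X - B * (A + D) * X = (W * X - B * A * X) - B * D * X := by
    rw [Matrix.mul_add, Matrix.add_mul]; abel
  have h1 : frobInner (gradA W X A B) D = - frobInner (W * X - B * A * X) (B * D * X) := by
    unfold frobInner gradA
    rw [← neg_sub (W * X) (B * A * X)]
    simp only [Matrix.transpose_mul, Matrix.transpose_transpose, Matrix.transpose_neg,
      Matrix.mul_neg, Matrix.neg_mul, Matrix.trace_neg]
    rw [Matrix.mul_assoc X, Matrix.trace_mul_comm X]
    simp only [Matrix.mul_assoc]
  have h2 : frobInner D (hessA X B D) = frobSq (B * D * X) := by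
    rw [frobSq_eq_frobInner]
    unfold frobInner hessA
    simp only [Matrix.transpose_mul, Matrix.mul_assoc]
    rw [Matrix.trace_mul_comm Xᵀ]
    simp only [Matrix.mul_assoc]
  unfold layerLoss
  rw [e, frobSq_sub, h1, h2]
  ring

/-- The loss is exactly quadratic in `B`, with gradient `gradB` and Hessian `hessB`. -/
theorem layerLoss_add_B {d r m : ℕ} (W : Matrix (Fin d) (Fin d) ℝ) (X : Matrix (Fin d) (Fin m) ℝ)
    (A : Matrix (Fin r) (Fin d) ℝ) (B D : Matrix (Fin d) (Fin r) ℝ) :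
    layerLoss W X A (B + D) = layerLoss W X A B + frobInner (gradB W X A B) D +
      1 / 2 * frobInner D (hessB X A D) := by
  have e : W * X - (B + D) * A * X = (W * X - B * A * X) - D * A * X := by
    rw [Matrix.add_mul, Matrix.add_mul]; abel
  have h1 : frobInner (gradB W X A B) D = - frobInner (W * X - B * A * X) (D * A * X) := by
    unfold frobInner gradB
    rw [← neg_sub (W * X) (B * A * X), Matrix.transpose_mul, Matrix.transpose_transpose,
      Matrix.transpose_neg, Matrix.mul_neg, Matrix.neg_mul, Matrix.trace_neg,
      Matrix.mul_assoc (A * X), Matrix.trace_mul_comm (A * X)]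
    simp only [Matrix.mul_assoc]
  have h2 : frobInner D (hessB X A D) = frobSq (D * A * X) := by
    rw [frobSq_eq_frobInner]
    unfold frobInner hessB
    rw [← Matrix.mul_assoc, Matrix.trace_mul_comm, ← Matrix.mul_assoc, Matrix.mul_assoc D A X,
      Matrix.transpose_mul D]
  unfold layerLoss
  rw [e, frobSq_sub, h1, h2]
  ring

/-- Score of the block `A`: `‖g‖² - (η / 2) ⟨g, H g⟩`. -/
def scoreA {d r m : ℕ} (η : ℝ) (W : Matrix (Fin d) (Fin d) ℝ) (X : Matrix (Fin d) (Fin m) ℝ)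
    (A : Matrix (Fin r) (Fin d) ℝ) (B : Matrix (Fin d) (Fin r) ℝ) : ℝ :=
  frobSq (gradA W X A B) - η / 2 * frobInner (gradA W X A B) (hessA X B (gradA W X A B))

/-- Score of the block `B`: `‖g‖² - (η / 2) ⟨g, H g⟩`. -/
def scoreB {d r m : ℕ} (η : ℝ) (W : Matrix (Fin d) (Fin d) ℝ) (X : Matrix (Fin d) (Fin m) ℝ)
    (A : Matrix (Fin r) (Fin d) ℝ) (B : Matrix (Fin d) (Fin r) ℝ) : ℝ :=
  frobSq (gradB W X A B) - η / 2 * frobInner (gradB W X A B) (hessB X A (gradB W X A B))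

/-- Subspace misalignment `‖W (I - A† A)‖_F`. -/
def misalignment {d r : ℕ} (W : Matrix (Fin d) (Fin d) ℝ) (A : Matrix (Fin r) (Fin d) ℝ) : ℝ :=
  frobNorm (W * (1 - pinv A * A))

/-- One round of AS-LoRA in one layer with the mode `M` (`0`: update `A`, `1`: update `B`): the
mode maximizes the score, the active block makes a gradient step, the other one is kept. -/
structure IsASRound {d r m : ℕ} (η : ℝ) (W : Matrix (Fin d) (Fin d) ℝ)
    (X : Matrix (Fin d) (Fin m) ℝ) (M : Fin 2)
    (A : Matrix (Fin r) (Fin d) ℝ) (B : Matrix (Fin d) (Fin r) ℝ)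
    (A' : Matrix (Fin r) (Fin d) ℝ) (B' : Matrix (Fin d) (Fin r) ℝ) : Prop where
  select_A : M = 0 → scoreB η W X A B ≤ scoreA η W X A B
  select_B : M = 1 → scoreA η W X A B ≤ scoreB η W X A B
  step_A : M = 0 → A' = A - η • gradA W X A B ∧ B' = B
  step_B : M = 1 → A' = A ∧ B' = B - η • gradB W X A B

/-- FFA-LoRA in one layer: `A` stays frozen, `B` makes a gradient step in every round. -/
def ffaB {d r m : ℕ} (η : ℝ) (W : Matrix (Fin d) (Fin d) ℝ) (X : Matrix (Fin d) (Fin m) ℝ)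
    (A : Matrix (Fin r) (Fin d) ℝ) (B₀ : Matrix (Fin d) (Fin r) ℝ) : ℕ → Matrix (Fin d) (Fin r) ℝ
  | 0 => B₀
  | t + 1 => ffaB η W X A B₀ t - η • gradB W X A (ffaB η W X A B₀ t)

/-! ## The whole model: `N` layers, random inputs and random initialization -/

/-- The objects of an experiment with `N` layers on a sample space `Ω`: the optimal pairs, the
stacked layer inputs, the modes and the AS-LoRA iterates. Both methods start at the iterates
`A · 0`, `B · 0`. -/
structure Experiment (Ω : Type*) (N d r m : ℕ) where
  /-- optimal down-projections `A⋆(n)` -/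
  Astar : Fin N → Matrix (Fin r) (Fin d) ℝ
  /-- optimal up-projections `B⋆(n)` -/
  Bstar : Fin N → Matrix (Fin d) (Fin r) ℝ
  /-- stacked inputs `X_n` -/
  X : Ω → Fin N → Matrix (Fin d) (Fin m) ℝ
  /-- mode `M^t(n)` -/
  M : Ω → ℕ → Fin N → Fin 2
  /-- AS-LoRA iterate `A^t(n)` -/
  A : Ω → ℕ → Fin N → Matrix (Fin r) (Fin d) ℝ
  /-- AS-LoRA iterate `B^t(n)` -/
  B : Ω → ℕ → Fin N → Matrix (Fin d) (Fin r) ℝ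

namespace Experiment

variable {Ω : Type*} {N d r m : ℕ}

/-- Optimal update `B⋆(n) A⋆(n)`. -/
def W (E : Experiment Ω N d r m) (n : Fin N) : Matrix (Fin d) (Fin d) ℝ := E.Bstar n * E.Astar n

/-- Subspace misalignment `δ^t(n)` of the AS-LoRA iterates. -/
def delta (E : Experiment Ω N d r m) (ω : Ω) (t : ℕ) (n : Fin N) : ℝ :=
  misalignment (E.W n) (E.A ω t n)

/-- Reconstruction risk of AS-LoRA after `t` rounds, averaged over the layers. -/
def riskAS (E : Experiment Ω N d r m) (t : ℕ) (ω : Ω) : ℝ :=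
  1 / (N : ℝ) * ∑ n, frobSq (E.W n * E.X ω n - E.B ω t n * E.A ω t n * E.X ω n)

/-- Reconstruction risk of FFA-LoRA with step size `η` after `t` rounds. -/
def riskFFA (E : Experiment Ω N d r m) (η : ℝ) (t : ℕ) (ω : Ω) : ℝ :=
  1 / (N : ℝ) * ∑ n, frobSq (E.W n * E.X ω n -
    ffaB η (E.W n) (E.X ω n) (E.A ω 0 n) (E.B ω 0 n) t * E.A ω 0 n * E.X ω n)

/-- Number of the first `T` rounds in which AS-LoRA activates the block `A` of layer `n`. -/
def countA (E : Experiment Ω N d r m) (ω : Ω) (n : Fin N) (T : ℕ) : ℕ :=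
  ((Finset.range T).filter (fun t => E.M ω t n = 0)).card

/-- The inputs, the initialization and the modes are random variables. -/
structure IsMeasurable [MeasurableSpace Ω] (E : Experiment Ω N d r m) : Prop where
  X : ∀ n i j, Measurable fun ω => E.X ω n i j
  A : ∀ n i j, Measurable fun ω => E.A ω 0 n i j
  B : ∀ n i j, Measurable fun ω => E.B ω 0 n i j
  M : ∀ t n, Measurable fun ω => E.M ω t n

/-- The iterates are generated by AS-LoRA with step size `η`. -/
def IsASLoRA (E : Experiment Ω N d r m) (η : ℝ) : Prop :=
  ∀ ω t n, IsASRound η (E.W n) (E.X ω n) (E.M ω t n) (E.A ω t n) (E.B ω t n)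
    (E.A ω (t + 1) n) (E.B ω (t + 1) n)

/-- Block strong convexity and block smoothness, `μ I ⪯ H_a ⪯ β I`, of the layer losses along the
AS-LoRA trajectory `ω`. The lower bound for the block `A` is not required at the initialization,
so that the usual choice `B⁰ = 0` is allowed. -/
structure BlockBounds (E : Experiment Ω N d r m) (μ β : ℝ) (ω : Ω) : Prop where
  lower_A : ∀ t n, 1 ≤ t → ∀ D, μ * frobSq D ≤ frobInner D (hessA (E.X ω n) (E.B ω t n) D)
  upper_A : ∀ t n D, frobInner D (hessA (E.X ω n) (E.B ω t n) D) ≤ β * frobSq D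
  lower_B : ∀ t n D, μ * frobSq D ≤ frobInner D (hessB (E.X ω n) (E.A ω t n) D)
  upper_B : ∀ t n D, frobInner D (hessB (E.X ω n) (E.A ω t n) D) ≤ β * frobSq D

/-- Well-conditioned input regime: the conditioning ratio is at most `κ` in every layer, and the
scale of the inputs is of constant order. -/
structure WellConditioned (E : Experiment Ω N d r m) (κ sLo sHi : ℝ) (ω : Ω) : Prop where
  ratio : ∀ n, sigmaMax (E.X ω n) ≤ κ * sigmaMinPos ((E.X ω n)ᵀ * pinv (E.A ω 0 n))
  scale_lower : ∀ n, sLo ≤ sigmaMax (E.X ω n)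
  scale_upper : ∀ n, sigmaMax (E.X ω n) ≤ sHi

end Experiment

end

end ASLoRA

/-! The loss of a layer is not jointly convex, yet its residual E = WX - BAX satisfies a joint
Polyak-Łojasiewicz inequality c‖E‖² ≤ ‖g_A‖² + ‖g_B‖² (`exists_gradient_domination`). The reason is
rank. With Z = AX, both Y = WX and BZ factor through r dimensions. If the r × r core K = BᵀYZᵀ is
invertible, then Y = YZᵀK⁻¹BᵀY, and E becomes linear in EZᵀ and BᵀE, which the two gradients
control. Since K = BᵀB ZZᵀ + BᵀEZᵀ, the core can only degenerate when BᵀEZᵀ has constant size; then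
the gradient in B is large while E is bounded (`exists_norm_residual_le`). The Hessian bounds,
tested on rank-one directions, provide the conditioning of B, AX and X.

A step in block a lowers the loss by exactly η S_a, and S_a ≥ ½‖g_a‖². The larger score therefore
pays for both gradients, and the residual contracts geometrically (`exists_geometric_decay`). Since
δ is at most ‖W - BA‖ and X is bounded below, δ decays at the same rate, and R_AS = 0.

FFA-LoRA is gradient descent on a strongly convex quadratic in B, so its risk tends to the minimum
over B (`ffaB_gap_le`). Per layer, every B leaves at least σ δ⁰² with σ = μ s_-²/β, while B = W A⁰†
leaves at most s_+² δ⁰². Hence R_FFA is comparable to the mean of E[δ⁰²], and it is positive as soon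
as some δ⁰ is positive with positive probability. -/

namespace ASLoRA

/-! ### Frobenius geometry and Gram matrices -/

section Frobenius

open scoped Matrix.Norms.Frobenius

variable {p q k l : ℕ}

theorem frobSq_nonneg (M : Matrix (Fin p) (Fin q) ℝ) : 0 ≤ frobSq M :=
  Finset.sum_nonneg fun _ _ => Finset.sum_nonneg fun _ _ => sq_nonneg _

theorem frobNorm_eq_norm (M : Matrix (Fin p) (Fin q) ℝ) : frobNorm M = ‖M‖ := by
  rw [frobNorm, frobSq, Matrix.frobenius_norm_def, Real.sqrt_eq_rpow]
  simp

theorem frobSq_eq_norm_sq (M : Matrix (Fin p) (Fin q) ℝ) : frobSq M = ‖M‖ ^ 2 := by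
  rw [← frobNorm_eq_norm, frobNorm, Real.sq_sqrt (frobSq_nonneg M)]

theorem frobSq_transpose (M : Matrix (Fin p) (Fin q) ℝ) : frobSq Mᵀ = frobSq M := by
  rw [frobSq_eq_norm_sq, frobSq_eq_norm_sq, Matrix.frobenius_norm_transpose]

theorem frobInner_comm (M N : Matrix (Fin p) (Fin q) ℝ) : frobInner M N = frobInner N M := by
  unfold frobInner
  rw [← Matrix.trace_transpose, Matrix.transpose_mul, Matrix.transpose_transpose]

theorem frobInner_mul_left (M : Matrix (Fin p) (Fin q) ℝ) (C : Matrix (Fin p) (Fin k) ℝ)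
    (N : Matrix (Fin k) (Fin q) ℝ) : frobInner M (C * N) = frobInner (Cᵀ * M) N := by
  simp [frobInner, Matrix.mul_assoc]

theorem frobInner_mul_right (M : Matrix (Fin p) (Fin q) ℝ) (N : Matrix (Fin p) (Fin k) ℝ)
    (C : Matrix (Fin k) (Fin q) ℝ) : frobInner M (N * C) = frobInner (M * Cᵀ) N := by
  unfold frobInner
  rw [Matrix.transpose_mul, Matrix.transpose_transpose, Matrix.mul_assoc, Matrix.trace_mul_comm C,
    Matrix.mul_assoc]

theorem frobInner_smul_right (c : ℝ) (M N : Matrix (Fin p) (Fin q) ℝ) :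
    frobInner M (c • N) = c * frobInner M N := by
  simp [frobInner]

theorem frobInner_smul_left (c : ℝ) (M N : Matrix (Fin p) (Fin q) ℝ) :
    frobInner (c • M) N = c * frobInner M N := by
  simp [frobInner]

theorem frobSq_smul (c : ℝ) (M : Matrix (Fin p) (Fin q) ℝ) : frobSq (c • M) = c ^ 2 * frobSq M := by
  rw [frobSq_eq_frobInner, frobSq_eq_frobInner, frobInner_smul_left, frobInner_smul_right]; ring

theorem frobInner_le_norm_mul_norm (M N : Matrix (Fin p) (Fin q) ℝ) :
    frobInner M N ≤ ‖M‖ * ‖N‖ := by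
  have h : frobInner M N ^ 2 ≤ (‖M‖ * ‖N‖) ^ 2 := by
    rw [mul_pow, ← frobSq_eq_norm_sq, ← frobSq_eq_norm_sq]
    have e1 : frobInner M N = ∑ x : Fin q × Fin p, M x.2 x.1 * N x.2 x.1 := by
      simp [frobInner, Matrix.trace, Matrix.mul_apply, Fintype.sum_prod_type]
    have e2 : ∀ M : Matrix (Fin p) (Fin q) ℝ, frobSq M = ∑ x : Fin q × Fin p, M x.2 x.1 ^ 2 := by
      intro M
      rw [frobSq, Fintype.sum_prod_type, Finset.sum_comm]
    rw [e1, e2, e2]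
    exact Finset.sum_mul_sq_le_sq_mul_sq _ _ _
  exact (abs_le_of_sq_le_sq' h (by positivity)).2

/-- Right multiplication by a symmetric idempotent splits the squared Frobenius norm. -/
theorem frobSq_eq_add_of_symm_idem {M : Matrix (Fin p) (Fin q) ℝ} {Q : Matrix (Fin q) (Fin q) ℝ}
    (hs : Qᵀ = Q) (hi : Q * Q = Q) : frobSq M = frobSq (M * Q) + frobSq (M * (1 - Q)) := by
  have h := frobSq_sub M (M * Q)
  have e : frobInner M (M * Q) = frobSq (M * Q) := by
    rw [frobSq_eq_frobInner, frobInner_mul_right (M * Q), hs, Matrix.mul_assoc, hi, frobInner_comm]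
  rw [Matrix.mul_sub, Matrix.mul_one, h, e]
  ring

theorem frobSq_one (k : ℕ) : frobSq (1 : Matrix (Fin k) (Fin k) ℝ) = k := by
  simp [frobSq_eq_frobInner, frobInner]

theorem norm_one_sq (k : ℕ) : ‖(1 : Matrix (Fin k) (Fin k) ℝ)‖ ^ 2 = k := by
  rw [← frobSq_eq_norm_sq, frobSq_one]

theorem frobSq_vecMulVec (u : Fin p → ℝ) (v : Fin q → ℝ) :
    frobSq (Matrix.vecMulVec u v) = (u ⬝ᵥ u) * (v ⬝ᵥ v) := by
  simp only [frobSq, Matrix.vecMulVec_apply, dotProduct, Finset.sum_mul_sum]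
  exact Finset.sum_congr rfl fun _ _ => Finset.sum_congr rfl fun _ _ => by ring

theorem frobSq_eq_sum_rows (M : Matrix (Fin p) (Fin q) ℝ) :
    frobSq M = ∑ i, M.row i ⬝ᵥ M.row i := by
  simp only [frobSq, dotProduct, Matrix.row, pow_two]

theorem row_mul (M : Matrix (Fin p) (Fin q) ℝ) (X : Matrix (Fin q) (Fin k) ℝ) (i : Fin p) :
    (M * X).row i = M.row i ᵥ* X := by
  ext j; simp [Matrix.row, Matrix.mul_apply, Matrix.vecMul, dotProduct]

theorem frobSq_mul_le {X : Matrix (Fin q) (Fin k) ℝ} {c : ℝ}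
    (h : ∀ v, (v ᵥ* X) ⬝ᵥ (v ᵥ* X) ≤ c * (v ⬝ᵥ v)) (M : Matrix (Fin p) (Fin q) ℝ) :
    frobSq (M * X) ≤ c * frobSq M := by
  rw [frobSq_eq_sum_rows, frobSq_eq_sum_rows M, Finset.mul_sum]
  exact Finset.sum_le_sum fun i _ => by rw [row_mul]; exact h _

theorem le_frobSq_mul {X : Matrix (Fin q) (Fin k) ℝ} {c : ℝ}
    (h : ∀ v, c * (v ⬝ᵥ v) ≤ (v ᵥ* X) ⬝ᵥ (v ᵥ* X)) (M : Matrix (Fin p) (Fin q) ℝ) :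
    c * frobSq M ≤ frobSq (M * X) := by
  rw [frobSq_eq_sum_rows, frobSq_eq_sum_rows (M * X), Finset.mul_sum]
  exact Finset.sum_le_sum fun i _ => by rw [row_mul]; exact h _

/-- Lower bound for the Gram matrix of a matrix that is bounded below. -/
theorem le_norm_mul_gram {X : Matrix (Fin q) (Fin k) ℝ} {c : ℝ} {D : Matrix (Fin p) (Fin q) ℝ}
    (h : c * frobSq D ≤ frobSq (D * X)) : c * ‖D‖ ≤ ‖D * (X * Xᵀ)‖ := by
  rcases (norm_nonneg D).eq_or_lt with h0 | h0
  · rw [← h0, mul_zero]; exact norm_nonneg _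
  have e : frobSq (D * X) = frobInner D (D * (X * Xᵀ)) := by
    rw [← Matrix.mul_assoc, frobInner_mul_right, Matrix.transpose_transpose, frobSq_eq_frobInner]
  have h2 := frobInner_le_norm_mul_norm D (D * (X * Xᵀ))
  rw [← e] at h2
  rw [frobSq_eq_norm_sq D] at h
  refine le_of_mul_le_mul_left ?_ h0
  nlinarith

/-- Cauchy-Schwarz in ‖DX‖² = ⟨D, DXXᵀ⟩, combined with `le_norm_mul_gram`. It removes the factor
`Xᵀ` from the gradient in `A`. -/
theorem le_norm_mul_mul_transpose {X : Matrix (Fin q) (Fin k) ℝ} {c : ℝ} (hc : 0 < c)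
    {D : Matrix (Fin p) (Fin q) ℝ} (h : c * frobSq D ≤ frobSq (D * X)) :
    c * frobSq (D * X) ≤ frobSq (D * (X * Xᵀ)) := by
  have e : frobSq (D * X) = frobInner D (D * (X * Xᵀ)) := by
    rw [← Matrix.mul_assoc, frobInner_mul_right, Matrix.transpose_transpose, frobSq_eq_frobInner]
  have h2 := frobInner_le_norm_mul_norm D (D * (X * Xᵀ))
  have h1 := le_norm_mul_gram h
  rw [e, frobSq_eq_norm_sq]
  nlinarith [norm_nonneg D, norm_nonneg (D * (X * Xᵀ))]

/-- A vector v in the left kernel gives the rank-one matrix D = vvᵀ with DK = 0. -/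
theorem isUnit_of_le_norm_mul {K : Matrix (Fin q) (Fin q) ℝ} {c : ℝ} (hc : 0 < c)
    (h : ∀ D : Matrix (Fin q) (Fin q) ℝ, c * ‖D‖ ≤ ‖D * K‖) : IsUnit K := by
  rw [← Matrix.vecMul_injective_iff_isUnit, ← Matrix.coe_vecMulLinear, ← LinearMap.ker_eq_bot,
    LinearMap.ker_eq_bot']
  intro v hv
  rw [Matrix.vecMulLinear_apply] at hv
  have h1 := h (Matrix.vecMulVec v v)
  rw [Matrix.vecMulVec_mul, hv, Matrix.vecMulVec_zero, norm_zero] at h1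
  have h2 : ‖Matrix.vecMulVec v v‖ = 0 := by
    nlinarith [norm_nonneg (Matrix.vecMulVec v v)]
  have h3 := frobSq_vecMulVec v v
  rw [frobSq_eq_norm_sq, h2] at h3
  have : v ⬝ᵥ v = 0 := by nlinarith
  exact dotProduct_self_eq_zero.1 this

/-- The estimate at D = K⁻¹; √q is the Frobenius norm of the identity. -/
theorem norm_inv_le {K : Matrix (Fin q) (Fin q) ℝ} {c : ℝ} (hc : 0 < c)
    (h : ∀ D : Matrix (Fin q) (Fin q) ℝ, c * ‖D‖ ≤ ‖D * K‖) : ‖K⁻¹‖ ≤ √q / c := by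
  have hu := (Matrix.isUnit_iff_isUnit_det _).1 (isUnit_of_le_norm_mul hc h)
  have h1 := h K⁻¹
  rw [Matrix.nonsing_inv_mul _ hu] at h1
  have h2 : ‖(1 : Matrix (Fin q) (Fin q) ℝ)‖ = √q := by
    rw [← norm_one_sq, Real.sqrt_sq (norm_nonneg _)]
  rw [le_div_iff₀ hc, ← h2]
  linarith

end Frobenius

/-! ### Extremal singular values and rank -/

section SingularValues

variable {p q : ℕ}

theorem sigmaMax_nonneg (M : Matrix (Fin p) (Fin q) ℝ) : 0 ≤ sigmaMax M :=
  LinearMap.singularValues_nonneg _ _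

theorem norm_toEuclideanLin_sq (M : Matrix (Fin p) (Fin q) ℝ) (u : EuclideanSpace ℝ (Fin q)) :
    ‖Matrix.toEuclideanLin M u‖ ^ 2 = (M *ᵥ u.ofLp) ⬝ᵥ (M *ᵥ u.ofLp) := by
  rw [EuclideanSpace.norm_sq_eq]
  simp [dotProduct, pow_two]

theorem norm_map_sq_eq_inner {E F : Type*} [NormedAddCommGroup E] [InnerProductSpace ℝ E]
    [NormedAddCommGroup F] [InnerProductSpace ℝ F] [FiniteDimensional ℝ E] [FiniteDimensional ℝ F]
    (T : E →ₗ[ℝ] F) (u : E) : ‖T u‖ ^ 2 = inner ℝ ((T.adjoint ∘ₗ T) u) u := by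
  rw [LinearMap.comp_apply, LinearMap.adjoint_inner_left, real_inner_self_eq_norm_sq]

/-- In an orthonormal eigenbasis of T*T, ‖Tu‖² is the sum of the σᵢ²⟨u, bᵢ⟩². -/
theorem norm_map_sq_le_singularValues_zero {E F : Type*} [NormedAddCommGroup E]
    [InnerProductSpace ℝ E] [NormedAddCommGroup F] [InnerProductSpace ℝ F] [FiniteDimensional ℝ E]
    [FiniteDimensional ℝ F] (T : E →ₗ[ℝ] F) (u : E) :
    ‖T u‖ ^ 2 ≤ T.singularValues 0 ^ 2 * ‖u‖ ^ 2 := by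
  have hs := T.isSymmetric_adjoint_comp_self
  set b := hs.eigenvectorBasis rfl
  rw [norm_map_sq_eq_inner, ← b.sum_inner_mul_inner, ← real_inner_self_eq_norm_sq u,
    ← b.sum_inner_mul_inner, Finset.mul_sum]
  refine Finset.sum_le_sum fun i _ => ?_
  have e : inner ℝ ((T.adjoint ∘ₗ T) u) (b i) = T.singularValues i ^ 2 * inner ℝ u (b i) := by
    rw [hs u (b i), hs.apply_eigenvectorBasis, T.sq_singularValues_fin rfl, inner_smul_right]
    rfl
  rw [e, real_inner_comm u (b i)]
  have h1 : T.singularValues i ≤ T.singularValues 0 := T.singularValues_antitone (Nat.zero_le _)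
  have h2 := T.singularValues_nonneg i
  rw [mul_assoc]
  exact mul_le_mul_of_nonneg_right (pow_le_pow_left₀ h2 h1 2) (mul_self_nonneg _)

theorem exists_norm_map_sq_eq {E F : Type*} [NormedAddCommGroup E]
    [InnerProductSpace ℝ E] [NormedAddCommGroup F] [InnerProductSpace ℝ F] [FiniteDimensional ℝ E]
    [FiniteDimensional ℝ F] (T : E →ₗ[ℝ] F) (h : 0 < T.singularValues 0) :
    ∃ u : E, u ≠ 0 ∧ ‖T u‖ ^ 2 = T.singularValues 0 ^ 2 * ‖u‖ ^ 2 := by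
  have hn : 0 < Module.finrank ℝ E := by
    by_contra h0
    rw [T.singularValues_of_finrank_le (by omega)] at h
    exact h.false
  obtain ⟨u, hu⟩ := (T.hasEigenvalue_adjoint_comp_self_sq_singularValues hn).exists_hasEigenvector
  refine ⟨u, hu.2, ?_⟩
  rw [norm_map_sq_eq_inner, hu.apply_eq_smul, inner_smul_left, real_inner_self_eq_norm_sq]
  simp

theorem mulVec_dotProduct_le_sigmaMax (M : Matrix (Fin p) (Fin q) ℝ) (u : Fin q → ℝ) :
    (M *ᵥ u) ⬝ᵥ (M *ᵥ u) ≤ sigmaMax M ^ 2 * (u ⬝ᵥ u) := by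
  have h := norm_map_sq_le_singularValues_zero (Matrix.toEuclideanLin M) (WithLp.toLp 2 u)
  rw [norm_toEuclideanLin_sq, EuclideanSpace.norm_sq_eq] at h
  simpa [dotProduct, pow_two, sigmaMax] using h

theorem dotProduct_sq_le (u v : Fin p → ℝ) : (u ⬝ᵥ v) ^ 2 ≤ (u ⬝ᵥ u) * (v ⬝ᵥ v) := by
  have := Finset.sum_mul_sq_le_sq_mul_sq Finset.univ u v
  simpa [dotProduct, pow_two] using this

theorem dotProduct_self_nonneg_real (u : Fin p → ℝ) : 0 ≤ u ⬝ᵥ u :=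
  Finset.sum_nonneg fun _ _ => mul_self_nonneg _

/-- Cauchy-Schwarz transposes the bound: ‖vM‖⁴ = ⟨v, M(vM)⟩² ≤ ‖v‖² σ² ‖vM‖². -/
theorem vecMul_dotProduct_le_sigmaMax (M : Matrix (Fin p) (Fin q) ℝ) (v : Fin p → ℝ) :
    (v ᵥ* M) ⬝ᵥ (v ᵥ* M) ≤ sigmaMax M ^ 2 * (v ⬝ᵥ v) := by
  have h1 := mulVec_dotProduct_le_sigmaMax M (v ᵥ* M)
  have h2 := dotProduct_sq_le v (M *ᵥ (v ᵥ* M))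
  rw [Matrix.dotProduct_mulVec] at h2
  have h3 := dotProduct_self_nonneg_real (v ᵥ* M)
  have h4 := dotProduct_self_nonneg_real v
  rcases h3.eq_or_lt with h0 | h0
  · rw [← h0]; positivity
  · refine le_of_mul_le_mul_left ?_ h0
    nlinarith

/-- The witness is Mu for a top right singular vector u; it is nonzero because s > 0. -/
theorem exists_vecMul_dotProduct_ge {M : Matrix (Fin p) (Fin q) ℝ} {s : ℝ} (hs : 0 < s)
    (h : s ≤ sigmaMax M) :
    ∃ v : Fin p → ℝ, 0 < v ⬝ᵥ v ∧ s ^ 2 * (v ⬝ᵥ v) ≤ (v ᵥ* M) ⬝ᵥ (v ᵥ* M) := by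
  obtain ⟨u, hu, he⟩ := exists_norm_map_sq_eq (Matrix.toEuclideanLin M) (hs.trans_le h)
  have hu0 : 0 < u.ofLp ⬝ᵥ u.ofLp := by
    have : 0 < ‖u‖ ^ 2 := by positivity
    rw [EuclideanSpace.norm_sq_eq] at this
    simpa [dotProduct, pow_two] using this
  have he' : (M *ᵥ u.ofLp) ⬝ᵥ (M *ᵥ u.ofLp) = sigmaMax M ^ 2 * (u.ofLp ⬝ᵥ u.ofLp) := by
    rw [norm_toEuclideanLin_sq, EuclideanSpace.norm_sq_eq] at he
    simpa [dotProduct, pow_two, sigmaMax] using he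
  have hσ : s ^ 2 ≤ sigmaMax M ^ 2 := pow_le_pow_left₀ hs.le h 2
  have hpos : 0 < (M *ᵥ u.ofLp) ⬝ᵥ (M *ᵥ u.ofLp) := by
    rw [he']; exact mul_pos ((pow_pos hs 2).trans_le hσ) hu0
  refine ⟨M *ᵥ u.ofLp, hpos, ?_⟩
  have h2 := dotProduct_sq_le ((M *ᵥ u.ofLp) ᵥ* M) u.ofLp
  rw [← Matrix.dotProduct_mulVec] at h2
  set a := (M *ᵥ u.ofLp) ⬝ᵥ (M *ᵥ u.ofLp)
  refine le_of_mul_le_mul_right ?_ hu0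
  calc s ^ 2 * a * (u.ofLp ⬝ᵥ u.ofLp) ≤ sigmaMax M ^ 2 * a * (u.ofLp ⬝ᵥ u.ofLp) := by gcongr
    _ = a ^ 2 := by rw [pow_two a]; nth_rewrite 3 [he']; ring
    _ ≤ _ := h2

/-- The squared Frobenius norm is at most the inner dimension times the squared operator norm. -/
theorem frobSq_mul_le_inner_dim {r : ℕ} (B : Matrix (Fin p) (Fin r) ℝ)
    (A : Matrix (Fin r) (Fin q) ℝ) : frobSq (B * A) ≤ r * sigmaMax (B * A) ^ 2 := by
  -- BA = BB†(BA), and ‖BB†‖² = tr BB† = tr B†B = ‖B†B‖² ≤ r because B†B is an orthogonal projection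
  -- in dimension r.
  have hP := isPenroseInverse_pinv B
  set Q := pinv B * B
  have hQs : Qᵀ = Q := hP.symm_right
  have hQi : Q * Q = Q := by
    change pinv B * B * (pinv B * B) = pinv B * B
    rw [← Matrix.mul_assoc, hP.mul_mul']
  have hQ : frobSq Q ≤ r := by
    have := frobSq_eq_add_of_symm_idem (M := (1 : Matrix (Fin r) (Fin r) ℝ)) hQs hQi
    rw [frobSq_one, Matrix.one_mul] at this
    linarith [frobSq_nonneg ((1 : Matrix (Fin r) (Fin r) ℝ) * (1 - Q))]
  have hPQ : frobSq (B * pinv B) = frobSq Q := by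
    rw [frobSq_eq_frobInner, frobSq_eq_frobInner, frobInner, frobInner, hQs, hQi, hP.symm_left,
      ← Matrix.mul_assoc, hP.mul_mul, Matrix.trace_mul_comm]
  have e : frobSq (B * A) = frobSq (B * pinv B * (B * A)) := by
    rw [← Matrix.mul_assoc _ B A, hP.mul_mul]
  rw [e]
  refine (frobSq_mul_le (vecMul_dotProduct_le_sigmaMax (B * A)) _).trans ?_
  rw [hPQ, mul_comm]
  gcongr

end SingularValues

/-! ### Error bound for the factorization problem -/

section ResidualBound

open scoped Matrix.Norms.Frobenius

/-- If `Y = Bₛ Zₛ` has rank at most the rank `r` of `B Z` and the core `K = Bᵀ Y Zᵀ` is invertible,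
then `Y - B Z` is a linear expression in `(Y - B Z) Zᵀ` and `Bᵀ (Y - B Z)`. -/
theorem residual_eq_of_isUnit_core {d r m : ℕ} (Bs B : Matrix (Fin d) (Fin r) ℝ)
    (Zs Z : Matrix (Fin r) (Fin m) ℝ) (hK : IsUnit (Bᵀ * (Bs * Zs) * Zᵀ)) (hH : IsUnit (Z * Zᵀ)) :
    Bs * Zs - B * Z =
      (Bs * Zs - B * Z) * Zᵀ * (Bᵀ * (Bs * Zs) * Zᵀ)⁻¹ * (Bᵀ * (Bs * Zs)) +
      B * ((Z * Zᵀ) * ((Bᵀ * (Bs * Zs) * Zᵀ)⁻¹ * (Bᵀ * (Bs * Zs - B * Z) -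
        Bᵀ * (Bs * Zs - B * Z) * (Zᵀ * ((Z * Zᵀ)⁻¹ * Z))))) := by
  set K := Bᵀ * (Bs * Zs) * Zᵀ with hKdef
  set H := Z * Zᵀ with hHdef
  have hKd := (Matrix.isUnit_iff_isUnit_det _).1 hK
  have hHd := (Matrix.isUnit_iff_isUnit_det _).1 hH
  -- As the data have inner dimension r, K is a product of two square matrices, each invertible
  -- along with K. So K⁻¹ splits and cancels in YZᵀK⁻¹BᵀY.
  have hfac : K = (Bᵀ * Bs) * (Zs * Zᵀ) := by simp only [hKdef, Matrix.mul_assoc]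
  have hdet : IsUnit ((Bᵀ * Bs).det * (Zs * Zᵀ).det) := by rwa [← Matrix.det_mul, ← hfac]
  have h1 := isUnit_of_mul_isUnit_left hdet
  have h2 := isUnit_of_mul_isUnit_right hdet
  have hY : Bs * Zs = Bs * Zs * Zᵀ * K⁻¹ * (Bᵀ * (Bs * Zs)) := by
    rw [hfac, Matrix.mul_inv_rev]
    symm
    calc Bs * Zs * Zᵀ * ((Zs * Zᵀ)⁻¹ * (Bᵀ * Bs)⁻¹) * (Bᵀ * (Bs * Zs))
        = Bs * ((Zs * Zᵀ) * (Zs * Zᵀ)⁻¹) * (((Bᵀ * Bs)⁻¹ * (Bᵀ * Bs)) * Zs) := by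
          simp only [Matrix.mul_assoc]
      _ = Bs * Zs := by
          rw [Matrix.mul_nonsing_inv _ h2, Matrix.nonsing_inv_mul _ h1, Matrix.mul_one,
            Matrix.one_mul]
  -- Projecting BᵀE off the row space of Z kills the BZ part and leaves BᵀY - KH⁻¹Z.
  have hv : Bᵀ * (Bs * Zs - B * Z) - Bᵀ * (Bs * Zs - B * Z) * (Zᵀ * (H⁻¹ * Z)) =
      Bᵀ * (Bs * Zs) - K * (H⁻¹ * Z) := by
    have e : Bᵀ * (B * Z) * (Zᵀ * (H⁻¹ * Z)) = Bᵀ * (B * Z) := by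
      calc Bᵀ * (B * Z) * (Zᵀ * (H⁻¹ * Z)) = Bᵀ * B * ((Z * Zᵀ) * H⁻¹ * Z) := by
            simp only [Matrix.mul_assoc]
        _ = _ := by
          rw [← hHdef, Matrix.mul_nonsing_inv _ hHd, Matrix.one_mul, Matrix.mul_assoc]
    rw [Matrix.mul_sub, Matrix.sub_mul, e, hKdef, Matrix.mul_assoc _ Zᵀ]
    abel
  have hr : H * (K⁻¹ * (Bᵀ * (Bs * Zs) - K * (H⁻¹ * Z))) =
      H * K⁻¹ * (Bᵀ * (Bs * Zs)) - Z := by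
    rw [Matrix.mul_sub, ← Matrix.mul_assoc K⁻¹ K, Matrix.nonsing_inv_mul _ hKd, Matrix.one_mul,
      Matrix.mul_sub, ← Matrix.mul_assoc H H⁻¹, Matrix.mul_nonsing_inv _ hHd, Matrix.one_mul,
      ← Matrix.mul_assoc H K⁻¹]
  have hu : (Bs * Zs - B * Z) * Zᵀ = Bs * Zs * Zᵀ - B * H := by
    rw [Matrix.sub_mul, hHdef, Matrix.mul_assoc B]
  rw [hv, hr, hu, Matrix.sub_mul, Matrix.sub_mul, ← hY, Matrix.mul_sub]
  simp only [Matrix.mul_assoc]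
  abel

/-- Error bound for the factorization problem: a residual of rank-`r` data is controlled by its
products with well-conditioned rank-`r` factors. -/
theorem exists_norm_residual_le (r : ℕ) {g h b z y : ℝ} (hg : 0 < g) (hh : 0 < h) (hb : 0 < b)
    (hz : 0 < z) (hy : 0 < y) :
    ∃ C : ℝ, 0 < C ∧ ∀ (d m : ℕ) (Bs B : Matrix (Fin d) (Fin r) ℝ)
      (Zs Z : Matrix (Fin r) (Fin m) ℝ),
      (∀ D : Matrix (Fin r) (Fin r) ℝ, g * frobSq D ≤ frobSq (D * Bᵀ)) →
      (∀ D : Matrix (Fin r) (Fin r) ℝ, h * frobSq D ≤ frobSq (D * Z)) →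
      ‖B‖ ≤ b → ‖Z‖ ≤ z → ‖Bs * Zs‖ ≤ y →
      ‖Bs * Zs - B * Z‖ ≤ C * (‖(Bs * Zs - B * Z) * Zᵀ‖ + ‖Bᵀ * (Bs * Zs - B * Z)‖) := by
  set k := √r / (g * h / 2) with hk
  set i := √r / h with hi
  have hk0 : 0 ≤ k := by positivity
  have hi0 : 0 ≤ i := by positivity
  -- k and i bound K⁻¹ and (ZZᵀ)⁻¹. The first two summands serve the case of an invertible core, the
  -- last one the case of a large perturbation e.
  refine ⟨k * (b * y) + b * (z * z * (k * (1 + z * (i * z)))) + (y + b * z) * (2 * b / (g * h)),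
    by positivity, ?_⟩
  intro d m Bs B Zs Z hB hZ hBn hZn hYn
  set E := Bs * Zs - B * Z with hE
  set u := E * Zᵀ with hu
  set v := Bᵀ * E with hv
  have hu0 := norm_nonneg u
  have hv0 := norm_nonneg v
  have hEn : ‖E‖ ≤ y + b * z :=
    (norm_sub_le _ _).trans (add_le_add hYn ((Matrix.frobenius_norm_mul _ _).trans
      (mul_le_mul hBn hZn (norm_nonneg _) hb.le)))
  have hBt : ‖Bᵀ‖ ≤ b := by rwa [Matrix.frobenius_norm_transpose]
  have hZt : ‖Zᵀ‖ ≤ z := by rwa [Matrix.frobenius_norm_transpose]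
  set e := Bᵀ * E * Zᵀ with he
  -- K is BᵀB ZZᵀ plus e, and the unperturbed part is bounded below by gh; this threshold leaves
  -- gh/2 for K.
  by_cases hs : ‖e‖ ≤ g * h / 2
  · have hKe : Bᵀ * (Bs * Zs) * Zᵀ = Bᵀ * Bᵀᵀ * (Z * Zᵀ) + e := by
      rw [he, hE, Matrix.transpose_transpose, Matrix.mul_sub, Matrix.sub_mul]
      simp only [Matrix.mul_assoc]
      abel
    have hKlow : ∀ D : Matrix (Fin r) (Fin r) ℝ,
        g * h / 2 * ‖D‖ ≤ ‖D * (Bᵀ * (Bs * Zs) * Zᵀ)‖ := by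
      intro D
      have h1 := le_norm_mul_gram (hB D)
      have h2 := le_norm_mul_gram (hZ (D * (Bᵀ * Bᵀᵀ)))
      have h3 : ‖D * e‖ ≤ ‖D‖ * (g * h / 2) := (Matrix.frobenius_norm_mul _ _).trans
        (mul_le_mul_of_nonneg_left hs (norm_nonneg _))
      have h4 : D * (Bᵀ * Bᵀᵀ) * (Z * Zᵀ) = D * (Bᵀ * (Bs * Zs) * Zᵀ) - D * e := by
        rw [hKe, Matrix.mul_add, Matrix.mul_assoc D]; abel
      rw [h4] at h2
      have h5 := norm_sub_le (D * (Bᵀ * (Bs * Zs) * Zᵀ)) (D * e)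
      nlinarith
    have hKu := isUnit_of_le_norm_mul (by positivity) hKlow
    have hHlow := fun D : Matrix (Fin r) (Fin r) ℝ => le_norm_mul_gram (hZ D)
    have hHu := isUnit_of_le_norm_mul hh hHlow
    have hKi : ‖(Bᵀ * (Bs * Zs) * Zᵀ)⁻¹‖ ≤ k := norm_inv_le (by positivity) hKlow
    have hHi : ‖(Z * Zᵀ)⁻¹‖ ≤ i := norm_inv_le hh hHlow
    have key := residual_eq_of_isUnit_core Bs B Zs Z hKu hHu
    rw [← hE, ← hu, ← hv] at key
    have n1 : ‖u * (Bᵀ * (Bs * Zs) * Zᵀ)⁻¹ * (Bᵀ * (Bs * Zs))‖ ≤ ‖u‖ * k * (b * y) := by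
      refine (Matrix.frobenius_norm_mul _ _).trans (mul_le_mul
        ((Matrix.frobenius_norm_mul _ _).trans ?_) ((Matrix.frobenius_norm_mul _ _).trans ?_)
        (norm_nonneg _) (by positivity)) <;> gcongr
    have n2 : ‖v - v * (Zᵀ * ((Z * Zᵀ)⁻¹ * Z))‖ ≤ ‖v‖ * (1 + z * (i * z)) := by
      have : ‖v * (Zᵀ * ((Z * Zᵀ)⁻¹ * Z))‖ ≤ ‖v‖ * (z * (i * z)) := by
        refine (Matrix.frobenius_norm_mul _ _).trans (mul_le_mul_of_nonneg_left
          ((Matrix.frobenius_norm_mul _ _).trans (mul_le_mul hZt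
            ((Matrix.frobenius_norm_mul _ _).trans ?_) (norm_nonneg _) hz.le)) hv0)
        gcongr
      have := norm_sub_le v (v * (Zᵀ * ((Z * Zᵀ)⁻¹ * Z)))
      linarith
    have n3 : ‖B * ((Z * Zᵀ) * ((Bᵀ * (Bs * Zs) * Zᵀ)⁻¹ * (v - v * (Zᵀ * ((Z * Zᵀ)⁻¹ * Z)))))‖ ≤
        b * (z * z * (k * (‖v‖ * (1 + z * (i * z))))) := by
      refine (Matrix.frobenius_norm_mul _ _).trans (mul_le_mul hBn
        ((Matrix.frobenius_norm_mul _ _).trans (mul_le_mul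
          ((Matrix.frobenius_norm_mul _ _).trans ?_) ((Matrix.frobenius_norm_mul _ _).trans ?_)
          (norm_nonneg _) (by positivity))) (norm_nonneg _) hb.le) <;> gcongr
    have n4 : ‖E‖ ≤ ‖u‖ * k * (b * y) + b * (z * z * (k * (‖v‖ * (1 + z * (i * z))))) := by
      rw [key]
      exact (norm_add_le _ _).trans (add_le_add n1 n3)
    refine n4.trans ?_
    have t1 : 0 ≤ k * (b * y) * ‖v‖ := by positivity
    have t2 : 0 ≤ b * (z * z * (k * (1 + z * (i * z)))) * ‖u‖ := by positivity
    have t3 : 0 ≤ (y + b * z) * (2 * b / (g * h)) * (‖u‖ + ‖v‖) := by positivity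
    nlinarith
  -- Here ‖u‖ has a constant lower bound, so a multiple of it dominates the crude bound y + bz for
  -- ‖E‖.
  · have hbu : g * h / 2 ≤ b * ‖u‖ := by
      refine (not_le.1 hs).le.trans ?_
      rw [he, Matrix.mul_assoc]
      exact (Matrix.frobenius_norm_mul _ _).trans (mul_le_mul_of_nonneg_right hBt hu0)
    have h1 : 1 ≤ 2 * b / (g * h) * ‖u‖ := by
      rw [div_mul_eq_mul_div, le_div_iff₀ (by positivity)]; linarith
    have h2 : y + b * z ≤ (y + b * z) * (2 * b / (g * h) * ‖u‖) :=
      le_mul_of_one_le_right (by positivity) h1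
    have t1 : 0 ≤ (k * (b * y) + b * (z * z * (k * (1 + z * (i * z))))) * (‖u‖ + ‖v‖) := by
      positivity
    have t2 : 0 ≤ (y + b * z) * (2 * b / (g * h)) * ‖v‖ := by positivity
    nlinarith

end ResidualBound

/-! ### Conditioning of the factors from the Hessian bounds -/

section Layer

variable {d r m : ℕ}

theorem frobInner_hessA (X : Matrix (Fin d) (Fin m) ℝ) (B : Matrix (Fin d) (Fin r) ℝ)
    (D : Matrix (Fin r) (Fin d) ℝ) : frobInner D (hessA X B D) = frobSq (B * D * X) := by
  rw [hessA, frobInner_mul_right, Matrix.transpose_transpose, frobInner_mul_left,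
    Matrix.transpose_transpose, ← Matrix.mul_assoc, frobSq_eq_frobInner]

theorem frobInner_hessB (X : Matrix (Fin d) (Fin m) ℝ) (A : Matrix (Fin r) (Fin d) ℝ)
    (D : Matrix (Fin d) (Fin r) ℝ) : frobInner D (hessB X A D) = frobSq (D * A * X) := by
  rw [hessB, frobInner_mul_right, Matrix.transpose_transpose, ← Matrix.mul_assoc,
    frobSq_eq_frobInner]

theorem frobSq_mul_vecMulVec_mul (X : Matrix (Fin d) (Fin m) ℝ) (B : Matrix (Fin d) (Fin r) ℝ)
    (u : Fin r → ℝ) (v : Fin d → ℝ) :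
    frobSq (B * Matrix.vecMulVec u v * X) =
      ((B *ᵥ u) ⬝ᵥ (B *ᵥ u)) * ((v ᵥ* X) ⬝ᵥ (v ᵥ* X)) := by
  rw [Matrix.mul_vecMulVec, Matrix.vecMulVec_mul, frobSq_vecMulVec]

theorem single_dotProduct_self (i : Fin r) :
    (Pi.single i (1 : ℝ) : Fin r → ℝ) ⬝ᵥ Pi.single i 1 = 1 := by simp

/-- The Hessian bounds in `A` and the scale of the input bound the input from below. -/
theorem le_vecMul_input {μ β s : ℝ} (hβ : 0 < β) (hs : 0 < s) (hr : 0 < r)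
    {X : Matrix (Fin d) (Fin m) ℝ} {B : Matrix (Fin d) (Fin r) ℝ} (hX : s ≤ sigmaMax X)
    (hl : ∀ D, μ * frobSq D ≤ frobInner D (hessA X B D))
    (hu : ∀ D, frobInner D (hessA X B D) ≤ β * frobSq D) (v : Fin d → ℝ) :
    μ * s ^ 2 / β * (v ⬝ᵥ v) ≤ (v ᵥ* X) ⬝ᵥ (v ᵥ* X) := by
  -- On the direction e₀vᵀ the form is ‖Be₀‖²‖vX‖². The upper bound at a top direction v' gives
  -- ‖Be₀‖² ≤ β/s²; the lower bound then keeps ‖vX‖ away from zero.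
  obtain ⟨v', hv', hv's⟩ := exists_vecMul_dotProduct_ge hs hX
  have h1 := hl (Matrix.vecMulVec (Pi.single ⟨0, hr⟩ 1) v)
  have h2 := hu (Matrix.vecMulVec (Pi.single ⟨0, hr⟩ 1) v')
  rw [frobInner_hessA, frobSq_mul_vecMulVec_mul, frobSq_vecMulVec, single_dotProduct_self] at h1 h2
  set a := (B *ᵥ Pi.single ⟨0, hr⟩ 1) ⬝ᵥ (B *ᵥ Pi.single ⟨0, hr⟩ 1)
  have ha : 0 ≤ a := dotProduct_self_nonneg_real _
  have h3 : a * s ^ 2 ≤ β := by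
    refine le_of_mul_le_mul_right ?_ hv'
    nlinarith [mul_le_mul_of_nonneg_left hv's ha]
  rw [div_mul_eq_mul_div, div_le_iff₀ hβ]
  have h4 := mul_le_mul_of_nonneg_right h3 (dotProduct_self_nonneg_real (v ᵥ* X))
  nlinarith [mul_le_mul_of_nonneg_left h1 (sq_nonneg s)]

/-- On uv'ᵀ the form is ‖Bu‖²‖v'X‖² with ‖v'X‖ ≤ S‖v'‖; the scale s only guarantees a nonzero v'. -/
theorem le_mulVec_up {μ s S : ℝ} (hs : 0 < s) (hS : 0 < S)
    {X : Matrix (Fin d) (Fin m) ℝ} {B : Matrix (Fin d) (Fin r) ℝ} (hX : s ≤ sigmaMax X)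
    (hX' : sigmaMax X ≤ S)
    (hl : ∀ D, μ * frobSq D ≤ frobInner D (hessA X B D)) (u : Fin r → ℝ) :
    μ / S ^ 2 * (u ⬝ᵥ u) ≤ (u ᵥ* Bᵀ) ⬝ᵥ (u ᵥ* Bᵀ) := by
  obtain ⟨v', hv', -⟩ := exists_vecMul_dotProduct_ge hs hX
  have h1 := hl (Matrix.vecMulVec u v')
  rw [frobInner_hessA, frobSq_mul_vecMulVec_mul, frobSq_vecMulVec] at h1
  rw [Matrix.vecMul_transpose, div_mul_eq_mul_div, div_le_iff₀ (by positivity)]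
  have h2 := vecMul_dotProduct_le_sigmaMax X v'
  have h3 : sigmaMax X ^ 2 ≤ S ^ 2 := pow_le_pow_left₀ (sigmaMax_nonneg X) hX' 2
  have ha := dotProduct_self_nonneg_real (B *ᵥ u)
  refine le_of_mul_le_mul_right ?_ hv'
  calc μ * (u ⬝ᵥ u) * (v' ⬝ᵥ v') = μ * ((u ⬝ᵥ u) * (v' ⬝ᵥ v')) := by ring
    _ ≤ _ := h1
    _ ≤ (B *ᵥ u) ⬝ᵥ (B *ᵥ u) * (S ^ 2 * (v' ⬝ᵥ v')) := by
      refine mul_le_mul_of_nonneg_left (h2.trans ?_) ha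
      exact mul_le_mul_of_nonneg_right h3 hv'.le
    _ = _ := by ring

theorem frobSq_up_le {β s : ℝ} (hs : 0 < s)
    {X : Matrix (Fin d) (Fin m) ℝ} {B : Matrix (Fin d) (Fin r) ℝ} (hX : s ≤ sigmaMax X)
    (hu : ∀ D, frobInner D (hessA X B D) ≤ β * frobSq D) : frobSq B ≤ β / s ^ 2 * r := by
  obtain ⟨v', hv', hv's⟩ := exists_vecMul_dotProduct_ge hs hX
  rw [← frobSq_transpose, ← Matrix.one_mul Bᵀ, ← frobSq_one r]
  refine frobSq_mul_le (fun u => ?_) _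
  have h1 := hu (Matrix.vecMulVec u v')
  rw [frobInner_hessA, frobSq_mul_vecMulVec_mul, frobSq_vecMulVec] at h1
  rw [Matrix.vecMul_transpose, div_mul_eq_mul_div, le_div_iff₀ (by positivity)]
  have ha := dotProduct_self_nonneg_real (B *ᵥ u)
  refine le_of_mul_le_mul_right ?_ hv'
  nlinarith [mul_le_mul_of_nonneg_left hv's ha]

theorem frobSq_vecMulVec_mul_mul (X : Matrix (Fin d) (Fin m) ℝ) (A : Matrix (Fin r) (Fin d) ℝ)
    (u : Fin d → ℝ) (v : Fin r → ℝ) :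
    frobSq (Matrix.vecMulVec u v * A * X) =
      (u ⬝ᵥ u) * ((v ᵥ* (A * X)) ⬝ᵥ (v ᵥ* (A * X))) := by
  rw [Matrix.mul_assoc, Matrix.vecMulVec_mul, frobSq_vecMulVec]

theorem le_vecMul_down {μ : ℝ} (hd : 0 < d)
    {X : Matrix (Fin d) (Fin m) ℝ} {A : Matrix (Fin r) (Fin d) ℝ}
    (hl : ∀ D, μ * frobSq D ≤ frobInner D (hessB X A D)) (v : Fin r → ℝ) :
    μ * (v ⬝ᵥ v) ≤ (v ᵥ* (A * X)) ⬝ᵥ (v ᵥ* (A * X)) := by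
  have h1 := hl (Matrix.vecMulVec (Pi.single ⟨0, hd⟩ 1) v)
  rw [frobInner_hessB, frobSq_vecMulVec_mul_mul, frobSq_vecMulVec, single_dotProduct_self] at h1
  linarith

theorem vecMul_down_le {β : ℝ} (hd : 0 < d)
    {X : Matrix (Fin d) (Fin m) ℝ} {A : Matrix (Fin r) (Fin d) ℝ}
    (hu : ∀ D, frobInner D (hessB X A D) ≤ β * frobSq D) (v : Fin r → ℝ) :
    (v ᵥ* (A * X)) ⬝ᵥ (v ᵥ* (A * X)) ≤ β * (v ⬝ᵥ v) := by
  have h1 := hu (Matrix.vecMulVec (Pi.single ⟨0, hd⟩ 1) v)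
  rw [frobInner_hessB, frobSq_vecMulVec_mul_mul, frobSq_vecMulVec, single_dotProduct_self] at h1
  linarith

theorem frobSq_down_le {β : ℝ} (hd : 0 < d)
    {X : Matrix (Fin d) (Fin m) ℝ} {A : Matrix (Fin r) (Fin d) ℝ}
    (hu : ∀ D, frobInner D (hessB X A D) ≤ β * frobSq D) : frobSq (A * X) ≤ β * r := by
  rw [← Matrix.one_mul (A * X), ← frobSq_one r]
  exact frobSq_mul_le (vecMul_down_le hd hu) _

theorem dim_pos_of_sigmaMax_pos {X : Matrix (Fin d) (Fin m) ℝ} (h : 0 < sigmaMax X) : 0 < d := by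
  obtain ⟨v, hv, -⟩ := exists_vecMul_dotProduct_ge h le_rfl
  by_contra h0
  obtain rfl : d = 0 := by omega
  simp at hv

theorem frobSq_mul_input_le {S : ℝ} {X : Matrix (Fin d) (Fin m) ℝ} (hX : sigmaMax X ≤ S) {p : ℕ}
    (M : Matrix (Fin p) (Fin d) ℝ) : frobSq (M * X) ≤ S ^ 2 * frobSq M :=
  frobSq_mul_le (fun v => (vecMul_dotProduct_le_sigmaMax X v).trans
    (mul_le_mul_of_nonneg_right (pow_le_pow_left₀ (sigmaMax_nonneg X) hX 2)
      (dotProduct_self_nonneg_real v))) M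

/-! ### Gradient domination -/

open scoped Matrix.Norms.Frobenius in
theorem frobSq_add_le (M N : Matrix (Fin d) (Fin m) ℝ) :
    frobSq (M + N) ≤ 2 * (frobSq M + frobSq N) := by
  simp only [frobSq_eq_norm_sq]
  have := norm_add_le M N
  nlinarith [sq_nonneg (‖M‖ - ‖N‖), norm_nonneg (M + N)]

theorem frobSq_neg (M : Matrix (Fin d) (Fin m) ℝ) : frobSq (-M) = frobSq M := by simp [frobSq]

theorem frobSq_sub_le (M N : Matrix (Fin d) (Fin m) ℝ) :
    frobSq (M - N) ≤ 2 * (frobSq M + frobSq N) := by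
  rw [sub_eq_add_neg, ← frobSq_neg N]; exact frobSq_add_le _ _

open scoped Matrix.Norms.Frobenius in
/-- Joint gradient domination (Polyak-Łojasiewicz inequality) for the layer loss. -/
theorem exists_gradient_domination {μ β s S w : ℝ} (r : ℕ) (hμ : 0 < μ) (hβ : 0 < β) (hs : 0 < s)
    (hS : 0 < S) :
    ∃ c : ℝ, 0 < c ∧ ∀ (d m : ℕ) (As A : Matrix (Fin r) (Fin d) ℝ) (Bs B : Matrix (Fin d) (Fin r) ℝ)
      (X : Matrix (Fin d) (Fin m) ℝ), 0 < r → sigmaMax (Bs * As) ≤ w → s ≤ sigmaMax X →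
      sigmaMax X ≤ S →
      (∀ D, μ * frobSq D ≤ frobInner D (hessA X B D)) →
      (∀ D, frobInner D (hessA X B D) ≤ β * frobSq D) →
      (∀ D, μ * frobSq D ≤ frobInner D (hessB X A D)) →
      (∀ D, frobInner D (hessB X A D) ≤ β * frobSq D) →
      c * frobSq (Bs * As * X - B * A * X) ≤
        frobSq (gradA (Bs * As) X A B) + frobSq (gradB (Bs * As) X A B) := by
  set σ := μ * s ^ 2 / β
  have hσ : 0 < σ := by positivity
  -- g and h bound BᵀB and AX(AX)ᵀ from below; b, z, y bound the norms of B, AX, WX, with `+ 1` for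
  -- strict positivity.
  obtain ⟨C, hC, H⟩ := exists_norm_residual_le r (g := μ / S ^ 2) (h := μ)
    (b := √(β / s ^ 2 * r) + 1) (z := √(β * r) + 1) (y := √(S ^ 2 * (r * w ^ 2)) + 1)
    (by positivity) hμ (by positivity) (by positivity) (by positivity)
  refine ⟨1 / (2 * C ^ 2 * (1 + 1 / σ)), by positivity, ?_⟩
  intro d m As A Bs B X hr hW hXl hXu hAl hAu hBl hBu
  have hd := dim_pos_of_sigmaMax_pos (hs.trans_le hXl)
  have norm_le : ∀ {p q : ℕ} (M : Matrix (Fin p) (Fin q) ℝ) {c : ℝ}, frobSq M ≤ c → ‖M‖ ≤ √c + 1 := by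
    intro p q M c h
    rw [← frobNorm_eq_norm, frobNorm]
    exact (Real.sqrt_le_sqrt h).trans (by linarith)
  have key := H d m Bs B (As * X) (A * X) (le_frobSq_mul (le_mulVec_up hs hS hXl hXu hAl))
    (le_frobSq_mul (le_vecMul_down hd hBl)) (norm_le _ (frobSq_up_le hs hXl hAu))
    (norm_le _ (frobSq_down_le hd hBu)) (norm_le _ (by
      rw [← Matrix.mul_assoc]
      refine (frobSq_mul_input_le hXu _).trans (mul_le_mul_of_nonneg_left ?_ (sq_nonneg S))
      refine (frobSq_mul_le_inner_dim Bs As).trans (mul_le_mul_of_nonneg_left ?_ r.cast_nonneg)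
      exact pow_le_pow_left₀ (sigmaMax_nonneg _) hW 2))
  rw [← Matrix.mul_assoc, ← Matrix.mul_assoc] at key
  set E := Bs * As * X - B * A * X with hE
  have hgB : frobSq (gradB (Bs * As) X A B) = ‖E * (A * X)ᵀ‖ ^ 2 := by
    rw [gradB, ← neg_sub, ← hE, Matrix.neg_mul, frobSq_neg, frobSq_eq_norm_sq]
  -- BᵀE = DX with D = Bᵀ(W - BA), and the gradient is -DXXᵀ, so the lower bound σ on XXᵀ applies.
  have hgA : σ * ‖Bᵀ * E‖ ^ 2 ≤ frobSq (gradA (Bs * As) X A B) := by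
    have e1 : Bᵀ * E = Bᵀ * (Bs * As - B * A) * X := by
      rw [hE, Matrix.mul_assoc Bᵀ, Matrix.sub_mul]
    have e2 : gradA (Bs * As) X A B = -(Bᵀ * (Bs * As - B * A) * (X * Xᵀ)) := by
      rw [gradA, ← neg_sub, ← hE, Matrix.mul_neg, Matrix.neg_mul, e1, Matrix.mul_assoc _ X]
    rw [← frobSq_eq_norm_sq, e1, e2, frobSq_neg]
    exact le_norm_mul_mul_transpose hσ (le_frobSq_mul (le_vecMul_input hβ hs hr hXl hAl hAu) _)
  rw [hgB, frobSq_eq_norm_sq, div_mul_eq_mul_div, div_le_iff₀ (by positivity), one_mul]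
  set a := ‖E * (A * X)ᵀ‖
  set b := ‖Bᵀ * E‖
  set G := frobSq (gradA (Bs * As) X A B)
  have hb : b ^ 2 ≤ 1 / σ * G := by
    rw [div_mul_eq_mul_div, le_div_iff₀ hσ, one_mul, mul_comm]; exact hgA
  have hG : 0 ≤ G := frobSq_nonneg _
  calc ‖E‖ ^ 2 ≤ (C * (a + b)) ^ 2 := pow_le_pow_left₀ (norm_nonneg _) key 2
    _ = C ^ 2 * (a + b) ^ 2 := by ring
    _ ≤ C ^ 2 * (2 * (a ^ 2 + 1 / σ * G)) := by
      refine mul_le_mul_of_nonneg_left ?_ (sq_nonneg C)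
      nlinarith [sq_nonneg (a - b)]
    _ ≤ C ^ 2 * (2 * ((1 + 1 / σ) * (G + a ^ 2))) := by
      have : 0 ≤ 1 / σ := by positivity
      gcongr
      nlinarith [mul_nonneg this (sq_nonneg a)]
    _ = _ := by ring

/-! ### Descent and decay along AS-LoRA -/

/-- The loss is quadratic in a single block, so the score is the exact decrease per unit of step
size. -/
theorem layerLoss_step_A (η : ℝ) (W : Matrix (Fin d) (Fin d) ℝ) (X : Matrix (Fin d) (Fin m) ℝ)
    (A : Matrix (Fin r) (Fin d) ℝ) (B : Matrix (Fin d) (Fin r) ℝ) :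
    layerLoss W X (A - η • gradA W X A B) B = layerLoss W X A B - η * scoreA η W X A B := by
  rw [sub_eq_add_neg, ← neg_smul, layerLoss_add_A, frobInner_smul_right, frobInner_hessA,
    Matrix.mul_smul, Matrix.smul_mul, frobSq_smul, scoreA, frobInner_hessA, ← frobSq_eq_frobInner]
  ring

theorem layerLoss_step_B (η : ℝ) (W : Matrix (Fin d) (Fin d) ℝ) (X : Matrix (Fin d) (Fin m) ℝ)
    (A : Matrix (Fin r) (Fin d) ℝ) (B : Matrix (Fin d) (Fin r) ℝ) :
    layerLoss W X A (B - η • gradB W X A B) = layerLoss W X A B - η * scoreB η W X A B := by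
  rw [sub_eq_add_neg, ← neg_smul, layerLoss_add_B, frobInner_smul_right, frobInner_hessB,
    Matrix.smul_mul, Matrix.smul_mul, frobSq_smul, scoreB, frobInner_hessB, ← frobSq_eq_frobInner]
  ring

theorem half_frobSq_le_score {η β G h : ℝ} (hη : 0 < η) (hβ : 0 < β) (hηβ : η ≤ 1 / β)
    (hG : 0 ≤ G) (h1 : h ≤ β * G) : 1 / 2 * G ≤ G - η / 2 * h := by
  have : η * β ≤ 1 := by rwa [le_div_iff₀ hβ] at hηβ
  nlinarith [mul_le_mul_of_nonneg_left h1 hη.le, mul_le_mul_of_nonneg_right this hG]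

/-- Descent of the loss in a round of AS-LoRA. -/
theorem IsASRound.descent {η β : ℝ} (hη : 0 < η) (hβ : 0 < β) (hηβ : η ≤ 1 / β)
    {W : Matrix (Fin d) (Fin d) ℝ} {X : Matrix (Fin d) (Fin m) ℝ} {M : Fin 2}
    {A A' : Matrix (Fin r) (Fin d) ℝ} {B B' : Matrix (Fin d) (Fin r) ℝ}
    (h : IsASRound η W X M A B A' B')
    (hA : ∀ D, frobInner D (hessA X B D) ≤ β * frobSq D)
    (hB : ∀ D, frobInner D (hessB X A D) ≤ β * frobSq D) :
    frobSq (W * X - B' * A' * X) ≤ frobSq (W * X - B * A * X) -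
      η / 2 * (frobSq (gradA W X A B) + frobSq (gradB W X A B)) := by
  have sA : 1 / 2 * frobSq (gradA W X A B) ≤ scoreA η W X A B :=
    half_frobSq_le_score hη hβ hηβ (frobSq_nonneg _) (hA _)
  have sB : 1 / 2 * frobSq (gradB W X A B) ≤ scoreB η W X A B :=
    half_frobSq_le_score hη hβ hηβ (frobSq_nonneg _) (hB _)
  have hcase : M = 0 ∨ M = 1 := by omega
  -- The activated block has at least the mean of both scores, so both gradients enter the decrease.
  have hle : layerLoss W X A' B' ≤ layerLoss W X A B -
      η * ((scoreA η W X A B + scoreB η W X A B) / 2) := by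
    rcases hcase with hM | hM
    · obtain ⟨rfl, rfl⟩ := h.step_A hM
      rw [layerLoss_step_A]
      have := h.select_A hM
      nlinarith
    · obtain ⟨rfl, rfl⟩ := h.step_B hM
      rw [layerLoss_step_B]
      have := h.select_B hM
      nlinarith
  unfold layerLoss at hle
  nlinarith

/-- The misalignment is the distance of `W` to the row space of `A`. -/
theorem misalignment_sq_le (W : Matrix (Fin d) (Fin d) ℝ) (A : Matrix (Fin r) (Fin d) ℝ)
    (B : Matrix (Fin d) (Fin r) ℝ) : misalignment W A ^ 2 ≤ frobSq (W - B * A) := by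
  have hP := isPenroseInverse_pinv A
  rw [misalignment, frobNorm, Real.sq_sqrt (frobSq_nonneg _),
    -- Of the orthogonal splitting along the row space of A, only the part on which BA vanishes is
    -- kept.
    frobSq_eq_add_of_symm_idem (M := W - B * A) hP.symm_right
      (by rw [← Matrix.mul_assoc, hP.mul_mul'])]
  have e : (W - B * A) * (1 - pinv A * A) = W * (1 - pinv A * A) := by
    rw [Matrix.sub_mul, Matrix.mul_sub (B * A), Matrix.mul_one, Matrix.mul_assoc B A,
      ← Matrix.mul_assoc A, hP.mul_mul, sub_self, sub_zero]
  rw [e]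
  linarith [frobSq_nonneg ((W - B * A) * (pinv A * A))]

theorem misalignment_sq_mul_le {c : ℝ} (hc : 0 ≤ c) {X : Matrix (Fin d) (Fin m) ℝ}
    (hX : ∀ v, c * (v ⬝ᵥ v) ≤ (v ᵥ* X) ⬝ᵥ (v ᵥ* X)) (W : Matrix (Fin d) (Fin d) ℝ)
    (A : Matrix (Fin r) (Fin d) ℝ) (B : Matrix (Fin d) (Fin r) ℝ) :
    c * misalignment W A ^ 2 ≤ frobSq (W * X - B * A * X) := by
  rw [← Matrix.sub_mul]
  exact (mul_le_mul_of_nonneg_left (misalignment_sq_le W A B) hc).trans (le_frobSq_mul hX _)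

theorem frobSq_residual_le {β s S w : ℝ} (hs : 0 < s) (hβ : 0 ≤ β)
    {As A : Matrix (Fin r) (Fin d) ℝ} {Bs B : Matrix (Fin d) (Fin r) ℝ}
    {X : Matrix (Fin d) (Fin m) ℝ} (hW : sigmaMax (Bs * As) ≤ w) (hXl : s ≤ sigmaMax X)
    (hXu : sigmaMax X ≤ S)
    (hAu : ∀ D, frobInner D (hessA X B D) ≤ β * frobSq D)
    (hBu : ∀ D, frobInner D (hessB X A D) ≤ β * frobSq D) :
    frobSq (Bs * As * X - B * A * X) ≤
      2 * (S ^ 2 * (r * w ^ 2) + β * (β / s ^ 2 * r)) := by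
  refine (frobSq_sub_le _ _).trans ?_
  have h1 : frobSq (Bs * As * X) ≤ S ^ 2 * (r * w ^ 2) :=
    (frobSq_mul_input_le hXu _).trans (mul_le_mul_of_nonneg_left
      ((frobSq_mul_le_inner_dim Bs As).trans (mul_le_mul_of_nonneg_left
        (pow_le_pow_left₀ (sigmaMax_nonneg _) hW 2) r.cast_nonneg)) (sq_nonneg S))
  have h2 : frobSq (B * A * X) ≤ β * (β / s ^ 2 * r) := by
    have := hBu B
    rw [frobInner_hessB] at this
    exact this.trans (mul_le_mul_of_nonneg_left (frobSq_up_le hs hXl hAu) hβ)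
  linarith

/-- Geometric decay of the layer loss along AS-LoRA. -/
theorem exists_geometric_decay {μ β s S w η : ℝ} (r : ℕ) (hμ : 0 < μ) (hβ : 0 < β) (hs : 0 < s)
    (hS : 0 < S) (hη : 0 < η) (hηβ : η ≤ 1 / β) :
    ∃ K ρ : ℝ, 0 < K ∧ 0 < ρ ∧ ρ < 1 ∧ ∀ (d m : ℕ) (As : Matrix (Fin r) (Fin d) ℝ)
      (Bs : Matrix (Fin d) (Fin r) ℝ) (X : Matrix (Fin d) (Fin m) ℝ) (M : ℕ → Fin 2)
      (A : ℕ → Matrix (Fin r) (Fin d) ℝ) (B : ℕ → Matrix (Fin d) (Fin r) ℝ), 0 < r →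
      sigmaMax (Bs * As) ≤ w → s ≤ sigmaMax X → sigmaMax X ≤ S →
      (∀ t, IsASRound η (Bs * As) X (M t) (A t) (B t) (A (t + 1)) (B (t + 1))) →
      (∀ t, 1 ≤ t → ∀ D, μ * frobSq D ≤ frobInner D (hessA X (B t) D)) →
      (∀ t D, frobInner D (hessA X (B t) D) ≤ β * frobSq D) →
      (∀ t D, μ * frobSq D ≤ frobInner D (hessB X (A t) D)) →
      (∀ t D, frobInner D (hessB X (A t) D) ≤ β * frobSq D) →
      ∀ t, frobSq (Bs * As * X - B t * A t * X) ≤ K * (ρ ^ t) ^ 2 := by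
  obtain ⟨c, hc, H⟩ := exists_gradient_domination (w := w) r hμ hβ hs hS
  set L := 2 * (S ^ 2 * (r * w ^ 2) + β * (β / s ^ 2 * r)) with hL
  have hL0 : 0 ≤ L := by positivity
  -- The maximum keeps q positive whatever the size of ηc.
  set q := max (1 - η / 2 * c) (1 / 2) with hq
  have hq0 : 0 < q := lt_max_of_lt_right (by norm_num)
  have hq1 : q < 1 := max_lt (by have := mul_pos hη hc; linarith) (by norm_num)
  -- Squared norms contract by q, hence ρ = √q. The contraction starts at round 1, and dividing by q
  -- pays for that shift.
  refine ⟨(L + 1) / q, √q, by positivity, Real.sqrt_pos.2 hq0,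
    by rw [Real.sqrt_lt' one_pos]; simpa using hq1, ?_⟩
  intro d m As Bs X M A B hr hW hXl hXu hround hAl hAu hBl hBu
  have h0 : frobSq (Bs * As * X - B 0 * A 0 * X) ≤ L :=
    frobSq_residual_le hs hβ.le hW hXl hXu (hAu 0) (hBu 0)
  have hstep := fun t => (hround t).descent hη hβ hηβ (hAu t) (hBu t)
  have hdec : ∀ t, frobSq (Bs * As * X - B (t + 1) * A (t + 1) * X) ≤ L * q ^ t := by
    intro t
    induction t with
    | zero =>
      -- Round 0 gives monotonicity only, since strong convexity in A starts at round 1.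
      have h1 := hstep 0
      have h2 : 0 ≤ η / 2 * (frobSq (gradA (Bs * As) X (A 0) (B 0)) +
        frobSq (gradB (Bs * As) X (A 0) (B 0))) :=
        mul_nonneg (by positivity) (add_nonneg (frobSq_nonneg _) (frobSq_nonneg _))
      rw [pow_zero, mul_one]
      linarith
    | succ t ih =>
      have h1 := hstep (t + 1)
      have h2 := H d m As (A (t + 1)) Bs (B (t + 1)) X hr hW hXl hXu (hAl _ (by omega)) (hAu _)
        (hBl _) (hBu _)
      have h3 := mul_le_mul_of_nonneg_left h2 (by positivity : 0 ≤ η / 2)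
      have h4 := mul_le_mul_of_nonneg_right (le_max_left (1 - η / 2 * c) (1 / 2))
        (frobSq_nonneg (Bs * As * X - B (t + 1) * A (t + 1) * X))
      rw [← hq] at h4
      calc _ ≤ q * frobSq (Bs * As * X - B (t + 1) * A (t + 1) * X) := by linarith
        _ ≤ q * (L * q ^ t) := mul_le_mul_of_nonneg_left ih hq0.le
        _ = L * q ^ (t + 1) := by ring
  intro t
  rw [← pow_mul, mul_comm t 2, pow_mul, Real.sq_sqrt hq0.le]
  cases t with
  | zero =>
    rw [pow_zero, mul_one, le_div_iff₀ hq0]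
    nlinarith
  | succ t =>
    refine (hdec t).trans ?_
    rw [pow_succ, div_mul_eq_mul_div, le_div_iff₀ hq0, ← mul_assoc]
    have : 0 ≤ q ^ t * q := by positivity
    nlinarith

end Layer

/-! ### Linear convergence of FFA-LoRA -/

section FFA

variable {d r m : ℕ} {η μ β : ℝ} {W : Matrix (Fin d) (Fin d) ℝ} {X : Matrix (Fin d) (Fin m) ℝ}
  {A : Matrix (Fin r) (Fin d) ℝ}

theorem frobSq_step_B_le (hη : 0 < η) (hβ : 0 < β) (hηβ : η ≤ 1 / β)
    (hu : ∀ D, frobInner D (hessB X A D) ≤ β * frobSq D) (B : Matrix (Fin d) (Fin r) ℝ) :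
    frobSq (W * X - (B - η • gradB W X A B) * A * X) ≤
      frobSq (W * X - B * A * X) - η * frobSq (gradB W X A B) := by
  have sB : 1 / 2 * frobSq (gradB W X A B) ≤ scoreB η W X A B :=
    half_frobSq_le_score hη hβ hηβ (frobSq_nonneg _) (hu _)
  have h := layerLoss_step_B η W X A B
  unfold layerLoss at h
  nlinarith

theorem antitone_frobSq_ffaB (hη : 0 < η) (hβ : 0 < β) (hηβ : η ≤ 1 / β)
    (hu : ∀ D, frobInner D (hessB X A D) ≤ β * frobSq D) (B₀ : Matrix (Fin d) (Fin r) ℝ) :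
    Antitone fun t => frobSq (W * X - ffaB η W X A B₀ t * A * X) := by
  refine antitone_nat_of_succ_le fun t => ?_
  have h := frobSq_step_B_le (W := W) hη hβ hηβ hu (ffaB η W X A B₀ t)
  have := mul_nonneg hη.le (frobSq_nonneg (gradB W X A (ffaB η W X A B₀ t)))
  rw [ffaB]
  linarith

theorem frobSq_add (M N : Matrix (Fin d) (Fin m) ℝ) :
    frobSq (M + N) = frobSq M + 2 * frobInner M N + frobSq N := by
  have h := frobSq_sub M ((-1 : ℝ) • N)
  rw [frobInner_smul_right, frobSq_smul, neg_one_smul, sub_neg_eq_add] at h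
  rw [h]; ring

/-- Strong convexity in `B`: the gap to any competitor is controlled by the gradient. -/
theorem gap_le_gradB (hμ : 0 < μ) (hl : ∀ D, μ * frobSq D ≤ frobInner D (hessB X A D))
    (B B' : Matrix (Fin d) (Fin r) ℝ) :
    μ * (frobSq (W * X - B * A * X) - frobSq (W * X - B' * A * X)) ≤ frobSq (gradB W X A B) := by
  have h := layerLoss_add_B W X A B (B' - B)
  rw [add_sub_cancel] at h
  unfold layerLoss at h
  have h1 := hl (B' - B)
  -- Completing the square: ‖g + μ(B' - B)‖² ≥ 0.
  have h2 := frobSq_nonneg (gradB W X A B + μ • (B' - B))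
  rw [frobSq_add, frobInner_smul_right, frobSq_smul] at h2
  nlinarith

/-- A step removes at least ημ times the gap. The competitor is arbitrary, so the gap may be
negative; the induction only needs 1 - ημ ≥ 0. -/
theorem ffaB_gap_le (hη : 0 < η) (hμ : 0 < μ) (hβ : 0 < β) (hηβ : η ≤ 1 / β) (hq : η * μ ≤ 1)
    (hl : ∀ D, μ * frobSq D ≤ frobInner D (hessB X A D))
    (hu : ∀ D, frobInner D (hessB X A D) ≤ β * frobSq D) (B₀ B' : Matrix (Fin d) (Fin r) ℝ)
    (t : ℕ) :
    frobSq (W * X - ffaB η W X A B₀ t * A * X) - frobSq (W * X - B' * A * X) ≤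
      (1 - η * μ) ^ t * (frobSq (W * X - B₀ * A * X) - frobSq (W * X - B' * A * X)) := by
  induction t with
  | zero => simp [ffaB]
  | succ t ih =>
    have h1 := frobSq_step_B_le (W := W) hη hβ hηβ hu (ffaB η W X A B₀ t)
    have h2 := gap_le_gradB (W := W) hμ hl (ffaB η W X A B₀ t) B'
    have h3 := mul_le_mul_of_nonneg_left h2 hη.le
    have h4 := mul_le_mul_of_nonneg_left ih (sub_nonneg.2 hq)
    rw [ffaB, pow_succ']
    nlinarith

theorem le_of_hess_bounds (hr : 0 < r) (hd : 0 < d)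
    (hl : ∀ D, μ * frobSq D ≤ frobInner D (hessB X A D))
    (hu : ∀ D, frobInner D (hessB X A D) ≤ β * frobSq D) : μ ≤ β := by
  have h := (le_vecMul_down hd hl (Pi.single ⟨0, hr⟩ 1)).trans
    (vecMul_down_le hd hu (Pi.single ⟨0, hr⟩ 1))
  rwa [single_dotProduct_self, mul_one, mul_one] at h

theorem frobSq_pinv_residual_le {S : ℝ} (hX : sigmaMax X ≤ S) :
    frobSq (W * X - W * pinv A * A * X) ≤ S ^ 2 * misalignment W A ^ 2 := by
  have e : W * X - W * pinv A * A * X = W * (1 - pinv A * A) * X := by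
    rw [Matrix.mul_sub, Matrix.mul_one, Matrix.sub_mul, Matrix.mul_assoc W]
  rw [e, misalignment, frobNorm, Real.sq_sqrt (frobSq_nonneg _)]
  exact frobSq_mul_input_le hX _

open scoped Matrix.Norms.Frobenius in
-- The lower Hessian bound gives A full row rank, where A† has this closed form. It makes the
-- misalignment measurable, which the eigenvectors in `pinv` do not show.
theorem pinv_eq_of_gram {S : ℝ} (hμ : 0 < μ) (hd : 0 < d) (hS : 0 < S) (hX : sigmaMax X ≤ S)
    (hl : ∀ D, μ * frobSq D ≤ frobInner D (hessB X A D)) : pinv A = Aᵀ * (A * Aᵀ)⁻¹ := by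
  have hlow : ∀ D : Matrix (Fin r) (Fin r) ℝ, μ / S ^ 2 * frobSq D ≤ frobSq (D * A) := by
    intro D
    have h1 := le_frobSq_mul (le_vecMul_down hd hl) D
    rw [← Matrix.mul_assoc] at h1
    rw [div_mul_eq_mul_div, div_le_iff₀ (by positivity), mul_comm (frobSq (D * A))]
    exact h1.trans (frobSq_mul_input_le hX _)
  have hu := (Matrix.isUnit_iff_isUnit_det _).1 (isUnit_of_le_norm_mul
    (show 0 < μ / S ^ 2 by positivity) fun D => le_norm_mul_gram (hlow D))
  have e1 : A * (Aᵀ * (A * Aᵀ)⁻¹) = 1 := by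
    rw [← Matrix.mul_assoc, Matrix.mul_nonsing_inv _ hu]
  refine (isPenroseInverse_pinv A).unique ⟨?_, ?_, ?_, ?_⟩
  · rw [e1, Matrix.one_mul]
  · rw [Matrix.mul_assoc _ A, e1, Matrix.mul_one]
  · rw [e1, Matrix.transpose_one]
  · simp only [Matrix.transpose_mul, Matrix.transpose_nonsing_inv, Matrix.transpose_transpose,
      Matrix.mul_assoc]

theorem sigmaMinPos_of_isEmpty (M : Matrix (Fin m) (Fin 0) ℝ) : sigmaMinPos M = 0 :=
  LinearMap.singularValues_of_finrank_le _ (by simp)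

end FFA

/-! ### Measurability of iterates and risks -/

section Measurability

variable {Ω : Type*} [MeasurableSpace Ω] {p q k : ℕ}

theorem measurable_mul_entries {f : Ω → Matrix (Fin p) (Fin q) ℝ} {g : Ω → Matrix (Fin q) (Fin k) ℝ}
    (hf : ∀ i j, Measurable fun ω => f ω i j) (hg : ∀ i j, Measurable fun ω => g ω i j) :
    ∀ i j, Measurable fun ω => (f ω * g ω) i j := fun i j => by
  simp only [Matrix.mul_apply]
  exact Finset.measurable_fun_sum _ fun l _ => (hf i l).mul (hg l j)

theorem measurable_sub_entries {f g : Ω → Matrix (Fin p) (Fin q) ℝ}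
    (hf : ∀ i j, Measurable fun ω => f ω i j) (hg : ∀ i j, Measurable fun ω => g ω i j) :
    ∀ i j, Measurable fun ω => (f ω - g ω) i j := fun i j => (hf i j).sub (hg i j)

theorem measurable_transpose_entries {f : Ω → Matrix (Fin p) (Fin q) ℝ}
    (hf : ∀ i j, Measurable fun ω => f ω i j) : ∀ i j, Measurable fun ω => (f ω)ᵀ i j :=
  fun i j => hf j i

theorem measurable_smul_entries (c : ℝ) {f : Ω → Matrix (Fin p) (Fin q) ℝ}
    (hf : ∀ i j, Measurable fun ω => f ω i j) : ∀ i j, Measurable fun ω => (c • f ω) i j :=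
  fun i j => (hf i j).const_mul c

theorem measurable_const_entries (M : Matrix (Fin p) (Fin q) ℝ) :
    ∀ i j, Measurable fun _ : Ω => M i j := fun _ _ => measurable_const

theorem measurable_frobSq {f : Ω → Matrix (Fin p) (Fin q) ℝ}
    (hf : ∀ i j, Measurable fun ω => f ω i j) : Measurable fun ω => frobSq (f ω) :=
  Finset.measurable_fun_sum _ fun i _ => Finset.measurable_fun_sum _ fun j _ => (hf i j).pow_const 2

theorem measurable_det {f : Ω → Matrix (Fin p) (Fin p) ℝ}
    (hf : ∀ i j, Measurable fun ω => f ω i j) : Measurable fun ω => (f ω).det := by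
  simp only [Matrix.det_apply']
  exact Finset.measurable_fun_sum _ fun σ _ => (Finset.measurable_fun_prod _ fun i _ =>
    hf _ _).const_mul _

theorem measurable_inv_entries {f : Ω → Matrix (Fin p) (Fin p) ℝ}
    (hf : ∀ i j, Measurable fun ω => f ω i j) : ∀ i j, Measurable fun ω => (f ω)⁻¹ i j := by
  intro i j
  simp only [Matrix.inv_def, Matrix.smul_apply, Ring.inverse_eq_inv', smul_eq_mul,
    Matrix.adjugate_apply]
  refine (measurable_det hf).inv.mul (measurable_det fun a b => ?_)
  simp only [Matrix.updateRow_apply]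
  by_cases h : a = j
  · simp only [h, if_true]; exact measurable_const
  · simp only [h, if_false]; exact hf a b

theorem measurable_gradA_entries {d r m : ℕ} (W : Matrix (Fin d) (Fin d) ℝ)
    {X : Ω → Matrix (Fin d) (Fin m) ℝ} {A : Ω → Matrix (Fin r) (Fin d) ℝ}
    {B : Ω → Matrix (Fin d) (Fin r) ℝ} (hX : ∀ i j, Measurable fun ω => X ω i j)
    (hA : ∀ i j, Measurable fun ω => A ω i j) (hB : ∀ i j, Measurable fun ω => B ω i j) :
    ∀ i j, Measurable fun ω => gradA W (X ω) (A ω) (B ω) i j :=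
  measurable_mul_entries (measurable_mul_entries (measurable_transpose_entries hB)
    (measurable_sub_entries (measurable_mul_entries (measurable_mul_entries hB hA) hX)
      (measurable_mul_entries (measurable_const_entries W) hX))) (measurable_transpose_entries hX)

theorem measurable_gradB_entries {d r m : ℕ} (W : Matrix (Fin d) (Fin d) ℝ)
    {X : Ω → Matrix (Fin d) (Fin m) ℝ} {A : Ω → Matrix (Fin r) (Fin d) ℝ}
    {B : Ω → Matrix (Fin d) (Fin r) ℝ} (hX : ∀ i j, Measurable fun ω => X ω i j)
    (hA : ∀ i j, Measurable fun ω => A ω i j) (hB : ∀ i j, Measurable fun ω => B ω i j) :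
    ∀ i j, Measurable fun ω => gradB W (X ω) (A ω) (B ω) i j :=
  measurable_mul_entries
    (measurable_sub_entries (measurable_mul_entries (measurable_mul_entries hB hA) hX)
      (measurable_mul_entries (measurable_const_entries W) hX))
    (measurable_transpose_entries (measurable_mul_entries hA hX))

namespace Experiment

variable {N d r m : ℕ} {E : Experiment Ω N d r m} {η : ℝ}

theorem IsMeasurable.iterates (hE : E.IsMeasurable) (hAS : E.IsASLoRA η) (t : ℕ) (n : Fin N) :
    (∀ i j, Measurable fun ω => E.A ω t n i j) ∧ ∀ i j, Measurable fun ω => E.B ω t n i j := by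
  induction t with
  | zero => exact ⟨hE.A n, hE.B n⟩
  | succ t ih =>
    have hM : MeasurableSet {ω | E.M ω t n = 0} := hE.M t n (measurableSet_singleton 0)
    have hgA := measurable_sub_entries ih.1 (measurable_smul_entries η
      (measurable_gradA_entries (E.W n) (hE.X n) ih.1 ih.2))
    have hgB := measurable_sub_entries ih.2 (measurable_smul_entries η
      (measurable_gradB_entries (E.W n) (hE.X n) ih.1 ih.2))
    have hM1 : ∀ ω, E.M ω t n ≠ 0 → E.M ω t n = 1 := fun ω h => by omega
    refine ⟨fun i j => ?_, fun i j => ?_⟩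
    · have h := @Measurable.ite _ _ _ _ _ _ (fun ω => E.M ω t n = 0) inferInstance hM (hgA i j) (ih.1 i j)
      refine (congrArg Measurable (funext fun ω => ?_)).mp h
      by_cases h : E.M ω t n = 0
      · simp only [h, if_true]; rw [((hAS ω t n).step_A h).1]
      · simp only [h, if_false]; rw [((hAS ω t n).step_B (hM1 ω h)).1]
    · have h := @Measurable.ite _ _ _ _ _ _ (fun ω => E.M ω t n = 0) inferInstance hM (ih.2 i j) (hgB i j)
      refine (congrArg Measurable (funext fun ω => ?_)).mp h
      by_cases h : E.M ω t n = 0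
      · simp only [h, if_true]; rw [((hAS ω t n).step_A h).2]
      · simp only [h, if_false]; rw [((hAS ω t n).step_B (hM1 ω h)).2]

theorem IsMeasurable.ffaB_entries (hE : E.IsMeasurable) (η : ℝ) (t : ℕ) (n : Fin N) :
    ∀ i j, Measurable fun ω =>
      ffaB η (E.W n) (E.X ω n) (E.A ω 0 n) (E.B ω 0 n) t i j := by
  induction t with
  | zero => exact hE.B n
  | succ t ih =>
    exact measurable_sub_entries ih (measurable_smul_entries η
      (measurable_gradB_entries (E.W n) (hE.X n) (hE.A n) ih))

theorem IsMeasurable.riskAS (hE : E.IsMeasurable) (hAS : E.IsASLoRA η) (t : ℕ) :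
    Measurable (E.riskAS t) :=
  (Finset.measurable_fun_sum _ fun n _ => measurable_frobSq (measurable_sub_entries
    (measurable_mul_entries (measurable_const_entries _) (hE.X n)) (measurable_mul_entries
      (measurable_mul_entries (hE.iterates hAS t n).2 (hE.iterates hAS t n).1)
      (hE.X n)))).const_mul _

theorem IsMeasurable.riskFFA (hE : E.IsMeasurable) (η : ℝ) (t : ℕ) :
    Measurable (E.riskFFA η t) :=
  (Finset.measurable_fun_sum _ fun n _ => measurable_frobSq (measurable_sub_entries
    (measurable_mul_entries (measurable_const_entries _) (hE.X n)) (measurable_mul_entries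
      (measurable_mul_entries (hE.ffaB_entries η t n) (hE.A n)) (hE.X n)))).const_mul _

end Experiment

end Measurability

/-! ### Layer averages and the round count -/

theorem average_le {N : ℕ} {f : Fin N → ℝ} {c : ℝ} (hc : 0 ≤ c) (h : ∀ n, f n ≤ c) :
    1 / (N : ℝ) * ∑ n, f n ≤ c := by
  rcases N.eq_zero_or_pos with rfl | hN
  · simpa using hc
  · have : ∑ n, f n ≤ N * c := by
      simpa using Finset.sum_le_sum fun n (_ : n ∈ Finset.univ) => h n
    rw [div_mul_eq_mul_div, one_mul, div_le_iff₀ (by positivity)]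
    linarith

theorem average_mono {N : ℕ} {f g : Fin N → ℝ} (h : ∀ n, f n ≤ g n) :
    1 / (N : ℝ) * ∑ n, f n ≤ 1 / (N : ℝ) * ∑ n, g n :=
  mul_le_mul_of_nonneg_left (Finset.sum_le_sum fun n _ => h n) (by positivity)

/-- A geometric sequence is below `ε` after `O(log (1 / ε))` steps. -/
theorem exists_geometric_round {K ρ : ℝ} (hK : 0 < K) (hρ : 0 < ρ) (hρ1 : ρ < 1) :
    ∃ T : ℝ → ℕ, (fun ε : ℝ => (T ε : ℝ)) =O[𝓝[>] 0] (fun ε : ℝ => Real.log (1 / ε)) ∧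
      ∀ ε, 0 < ε → ∀ t, T ε ≤ t → K * ρ ^ t ≤ ε := by
  have hl : 0 < -Real.log ρ := neg_pos.2 (Real.log_neg hρ hρ1)
  refine ⟨fun ε => ⌈(Real.log K + Real.log (1 / ε)) / -Real.log ρ⌉₊, ?_, ?_⟩
  · have hlim : Tendsto (fun ε : ℝ => Real.log (1 / ε)) (𝓝[>] 0) atTop := by
      simp only [one_div]
      exact Real.tendsto_log_atTop.comp tendsto_inv_nhdsGT_zero
    have hc : ∀ c : ℝ, (fun _ : ℝ => c) =O[𝓝[>] 0] fun ε : ℝ => Real.log (1 / ε) := fun c =>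
      ((isLittleO_const_left.2 (Or.inr (tendsto_norm_atTop_atTop.comp hlim)))).isBigO
    -- The absolute value absorbs the truncation of negative numbers by the natural ceiling;
    -- constants are harmless because log(1/ε) tends to infinity.
    refine IsBigO.trans (g := fun ε => |(Real.log K + Real.log (1 / ε)) / -Real.log ρ| + 1) ?_ ?_
    · refine IsBigO.of_bound 1 (Eventually.of_forall fun ε => ?_)
      rw [one_mul, Real.norm_of_nonneg (Nat.cast_nonneg _), Real.norm_of_nonneg (by positivity)]
      refine (Nat.cast_le.2 (Nat.ceil_mono (le_abs_self _))).trans ?_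
      exact (Nat.ceil_lt_add_one (abs_nonneg _)).le
    · refine IsBigO.add ?_ (hc 1)
      simp only [div_eq_mul_inv (_ + _)]
      have := (((hc (Real.log K)).add (isBigO_refl _ _)).mul (isBigO_refl (fun _ : ℝ => (-Real.log ρ)⁻¹) (𝓝[>] 0)))
      refine (this.norm_left.trans ?_)
      simp only [mul_comm _ (-Real.log ρ)⁻¹]
      exact isBigO_const_mul_self _ _ _
  · intro ε hε t ht
    have h1 := Nat.ceil_le.1 ht
    rw [div_le_iff₀ hl, one_div, Real.log_inv] at h1
    have hpos : 0 < K * ρ ^ t := by positivity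
    rw [← Real.log_le_log_iff hpos hε, Real.log_mul hK.ne' (by positivity), Real.log_pow]
    linarith

/-! ### Risk bounds for a sample point, and integrability -/

namespace Experiment

variable {Ω : Type*} {N d r m : ℕ} {E : Experiment Ω N d r m} {η μ β κ sLo sHi w : ℝ} {ω : Ω}

/-- For r = 0 the matrix XᵀA† has no columns and `sigmaMinPos` takes the value 0, against the
positive scale of X. -/
theorem WellConditioned.rank_pos (hsLo : 0 < sLo) (hE : E.WellConditioned κ sLo sHi ω)
    (n : Fin N) : 0 < r := by
  by_contra h
  obtain rfl : r = 0 := by omega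
  have h1 := hE.ratio n
  rw [sigmaMinPos_of_isEmpty, mul_zero] at h1
  linarith [hE.scale_lower n]

theorem WellConditioned.dim_pos (hsLo : 0 < sLo) (hE : E.WellConditioned κ sLo sHi ω)
    (n : Fin N) : 0 < d := dim_pos_of_sigmaMax_pos (hsLo.trans_le (hE.scale_lower n))

theorem le_vecMul_X (hβ : 0 < β) (hsLo : 0 < sLo) (hb : E.BlockBounds μ β ω)
    (hc : E.WellConditioned κ sLo sHi ω) (n : Fin N) (v : Fin d → ℝ) :
    μ * sLo ^ 2 / β * (v ⬝ᵥ v) ≤ (v ᵥ* E.X ω n) ⬝ᵥ (v ᵥ* E.X ω n) :=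
  -- Round 1 is used because the lower bound in A may fail at the initialization; X is the same in
  -- all rounds.
  le_vecMul_input hβ hsLo (hc.rank_pos hsLo n) (hc.scale_lower n) (hb.lower_A 1 n le_rfl)
    (hb.upper_A 1 n) v

theorem riskAS_nonneg (t : ℕ) : 0 ≤ E.riskAS t ω :=
  mul_nonneg (by positivity) (Finset.sum_nonneg fun _ _ => frobSq_nonneg _)

theorem riskFFA_nonneg (t : ℕ) : 0 ≤ E.riskFFA η t ω :=
  mul_nonneg (by positivity) (Finset.sum_nonneg fun _ _ => frobSq_nonneg _)

theorem antitone_riskFFA (hη : 0 < η) (hβ : 0 < β) (hηβ : η ≤ 1 / β) (hb : E.BlockBounds μ β ω) :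
    Antitone fun t => E.riskFFA η t ω := fun _ _ hst =>
  average_mono fun n => antitone_frobSq_ffaB hη hβ hηβ (hb.upper_B 0 n) (E.B ω 0 n) hst

theorem riskFFA_zero_le (hβ : 0 < β) (hsLo : 0 < sLo)
    (hW : ∀ n, sigmaMax (E.W n) ≤ w) (hb : E.BlockBounds μ β ω)
    (hc : E.WellConditioned κ sLo sHi ω) :
    E.riskFFA η 0 ω ≤ 2 * (sHi ^ 2 * (r * w ^ 2) + β * (β / sLo ^ 2 * r)) :=
  average_le (by positivity) fun n => frobSq_residual_le hsLo hβ.le (hW n) (hc.scale_lower n)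
    (hc.scale_upper n) (hb.upper_A 0 n) (hb.upper_B 0 n)

theorem le_riskFFA (hμ : 0 < μ) (hβ : 0 < β) (hsLo : 0 < sLo) (hb : E.BlockBounds μ β ω)
    (hc : E.WellConditioned κ sLo sHi ω) (t : ℕ) :
    μ * sLo ^ 2 / β * (1 / (N : ℝ) * ∑ n, E.delta ω 0 n ^ 2) ≤ E.riskFFA η t ω := by
  rw [mul_left_comm, Finset.mul_sum]
  exact average_mono fun n => misalignment_sq_mul_le (by positivity)
    (le_vecMul_X hβ hsLo hb hc n) _ _ _

/-- The competitor is B' = WA†, whose residual is W(1 - A†A)X. The absolute value keeps the error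
term nonnegative even without layers, where μ ≤ β is not available. -/
theorem riskFFA_le (hη : 0 < η) (hμ : 0 < μ) (hβ : 0 < β) (hηβ : η ≤ 1 / β)
    (hsLo : 0 < sLo) (hW : ∀ n, sigmaMax (E.W n) ≤ w)
    (hb : E.BlockBounds μ β ω) (hc : E.WellConditioned κ sLo sHi ω) (t : ℕ) :
    E.riskFFA η t ω ≤ sHi ^ 2 * (1 / (N : ℝ) * ∑ n, E.delta ω 0 n ^ 2) +
      |1 - η * μ| ^ t * (2 * (sHi ^ 2 * (r * w ^ 2) + β * (β / sLo ^ 2 * r))) := by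
  set L := 2 * (sHi ^ 2 * (r * w ^ 2) + β * (β / sLo ^ 2 * r))
  have hL : 0 ≤ |1 - η * μ| ^ t * L := by positivity
  have key : ∀ n, frobSq (E.W n * E.X ω n -
      ffaB η (E.W n) (E.X ω n) (E.A ω 0 n) (E.B ω 0 n) t * E.A ω 0 n * E.X ω n) -
      sHi ^ 2 * E.delta ω 0 n ^ 2 ≤ |1 - η * μ| ^ t * L := by
    intro n
    have hμβ := le_of_hess_bounds (hc.rank_pos hsLo n) (hc.dim_pos hsLo n) (hb.lower_B 0 n)
      (hb.upper_B 0 n)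
    have hq : η * μ ≤ 1 := by
      rw [le_div_iff₀ hβ] at hηβ
      nlinarith
    have h1 := ffaB_gap_le (W := E.W n) hη hμ hβ hηβ hq (hb.lower_B 0 n) (hb.upper_B 0 n)
      (E.B ω 0 n) (E.W n * pinv (E.A ω 0 n)) t
    have h2 := frobSq_pinv_residual_le (W := E.W n) (A := E.A ω 0 n) (hc.scale_upper n)
    have h3 := frobSq_residual_le hsLo hβ.le (hW n) (hc.scale_lower n)
      (hc.scale_upper n) (hb.upper_A 0 n) (hb.upper_B 0 n)
    rw [abs_of_nonneg (sub_nonneg.2 hq)]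
    have h4 := mul_le_mul_of_nonneg_left h3 (pow_nonneg (sub_nonneg.2 hq) t)
    have h5 := mul_nonneg (pow_nonneg (sub_nonneg.2 hq) t)
      (frobSq_nonneg (E.W n * E.X ω n - E.W n * pinv (E.A ω 0 n) * E.A ω 0 n * E.X ω n))
    change frobSq (E.W n * E.X ω n - E.W n * pinv (E.A ω 0 n) * E.A ω 0 n * E.X ω n) ≤
      sHi ^ 2 * E.delta ω 0 n ^ 2 at h2
    rw [mul_sub] at h1
    change (1 - η * μ) ^ t * frobSq (E.W n * E.X ω n - E.B ω 0 n * E.A ω 0 n * E.X ω n) ≤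
      (1 - η * μ) ^ t * L at h4
    linarith
  have := average_le hL key
  rw [Finset.sum_sub_distrib, mul_sub, ← Finset.mul_sum, mul_left_comm (1 / (N : ℝ))] at this
  rw [riskFFA]
  linarith

theorem delta_sq_le (hW : ∀ n, sigmaMax (E.W n) ≤ w) (t : ℕ) (n : Fin N) :
    E.delta ω t n ^ 2 ≤ r * w ^ 2 := by
  have h := misalignment_sq_le (E.W n) (E.A ω t n) 0
  rw [Matrix.zero_mul, sub_zero] at h
  exact h.trans ((frobSq_mul_le_inner_dim _ _).trans (mul_le_mul_of_nonneg_left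
    (pow_le_pow_left₀ (sigmaMax_nonneg _) (hW n) 2) r.cast_nonneg))

variable [MeasurableSpace Ω] {P : Measure Ω} [IsProbabilityMeasure P]

theorem integrable_of_measurable_of_le {f : Ω → ℝ} {c : ℝ} (hf : AEStronglyMeasurable f P)
    (h0 : ∀ ω, 0 ≤ f ω) (hc : ∀ᵐ ω ∂P, f ω ≤ c) : Integrable f P :=
  Integrable.of_bound hf c (hc.mono fun ω h => by rwa [Real.norm_of_nonneg (h0 ω)])

/-- δ⁰² ≤ r w² holds everywhere, and almost surely δ⁰² agrees with the measurable expression given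
by `pinv_eq_of_gram`. -/
theorem integrable_delta_sq (hμ : 0 < μ) (hsLo : 0 < sLo) (hsHi : 0 < sHi)
    (hE : E.IsMeasurable) (hW : ∀ n, sigmaMax (E.W n) ≤ w) (hb : ∀ᵐ ω ∂P, E.BlockBounds μ β ω)
    (hc : ∀ᵐ ω ∂P, E.WellConditioned κ sLo sHi ω) (n : Fin N) :
    Integrable (fun ω => E.delta ω 0 n ^ 2) P := by
  refine integrable_of_measurable_of_le ?_ (fun ω => sq_nonneg _)
    (Eventually.of_forall fun ω => delta_sq_le hW 0 n)
  have hA := hE.A n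
  have hm : Measurable fun ω => frobSq (E.W n *
      (1 - (E.A ω 0 n)ᵀ * (E.A ω 0 n * (E.A ω 0 n)ᵀ)⁻¹ * E.A ω 0 n)) :=
    measurable_frobSq (measurable_mul_entries (measurable_const_entries _)
      (measurable_sub_entries (measurable_const_entries 1) (measurable_mul_entries
        (measurable_mul_entries (measurable_transpose_entries hA) (measurable_inv_entries
          (measurable_mul_entries hA (measurable_transpose_entries hA)))) hA)))
  refine hm.aestronglyMeasurable.congr ?_
  filter_upwards [hb, hc] with ω hbω hcω
  rw [← pinv_eq_of_gram hμ (hcω.dim_pos hsLo n) hsHi (hcω.scale_upper n) (hbω.lower_B 0 n),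
    delta, misalignment, frobNorm, Real.sq_sqrt (frobSq_nonneg _)]

end Experiment

end ASLoRA

/-! ### The comparison theorem -/

theorem corollary1 (μ β κ sLo sHi : ℝ) (hμ : 0 < μ) (hβ : 0 < β) (hκ : 0 < κ)
    (hsLo : 0 < sLo) (hsHi : 0 < sHi) :
    ∃ c₁ c₂ : ℝ, 0 < c₁ ∧ 0 < c₂ ∧
      ∀ (η w : ℝ) (r : ℕ), 0 < η → η ≤ 1 / β → 0 < w →
        ∃ (C ρ : ℝ) (T : ℝ → ℕ), 0 < C ∧ 0 < ρ ∧ ρ < 1 ∧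
          (fun ε : ℝ => (T ε : ℝ)) =O[𝓝[>] 0] (fun ε : ℝ => Real.log (1 / ε)) ∧
          ∀ (N d m : ℕ) (Ω : Type*) [MeasurableSpace Ω] (P : Measure Ω) [IsProbabilityMeasure P]
            (E : ASLoRA.Experiment Ω N d r m),
            E.IsMeasurable → E.IsASLoRA η →
            (∀ n, ASLoRA.sigmaMax (E.W n) ≤ w) →
            (∀ᵐ ω ∂P, E.BlockBounds μ β ω) →
            (∀ᵐ ω ∂P, E.WellConditioned κ sLo sHi ω) →
            (∀ᵐ ω ∂P, ∀ n, (fun t : ℕ => (E.countA ω n t : ℝ)) =Θ[atTop] (fun t : ℕ => (t : ℝ))) →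
            -- geometric contraction of the misalignment in every layer
            (∀ᵐ ω ∂P, ∀ t n, E.delta ω t n ≤ C * ρ ^ t) ∧
            -- after `T ε = O(log (1 / ε))` rounds the misalignment is at most `ε` in every layer,
            -- and the expected reconstruction risk is of order `ε²`
            (∀ ε : ℝ, 0 < ε → ∀ t : ℕ, T ε ≤ t →
              (∀ᵐ ω ∂P, ∀ n, E.delta ω t n ≤ ε) ∧ ∫ ω, E.riskAS t ω ∂P ≤ c₂ * ε ^ 2) ∧
            -- the limiting risks
            (∀ t, Integrable (E.riskAS t) P) ∧ (∀ t, Integrable (E.riskFFA η t) P) ∧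
            (∀ n, Integrable (fun ω => E.delta ω 0 n ^ 2) P) ∧
            ∃ RAS RFFA : ℝ,
              Tendsto (fun t => ∫ ω, E.riskAS t ω ∂P) atTop (𝓝 RAS) ∧
              Tendsto (fun t => ∫ ω, E.riskFFA η t ω ∂P) atTop (𝓝 RFFA) ∧
              (∀ ε : ℝ, 0 < ε → RAS ≤ c₂ * ε ^ 2) ∧
              c₁ * (1 / (N : ℝ) * ∑ n, ∫ ω, E.delta ω 0 n ^ 2 ∂P) ≤ RFFA ∧
              RFFA ≤ c₂ * (1 / (N : ℝ) * ∑ n, ∫ ω, E.delta ω 0 n ^ 2 ∂P) ∧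
              (∀ ε : ℝ, 0 < ε → (∃ n₀, 0 < P {ω | ε < E.delta ω 0 n₀}) → RAS < RFFA) := by
  open ASLoRA Experiment in
  set σ := μ * sLo ^ 2 / β with hσdef
  have hσ : 0 < σ := by positivity
  refine ⟨σ, sHi ^ 2, hσ, by positivity, fun η w r hη hηβ hw => ?_⟩
  obtain ⟨K, ρ, hK, hρ, hρ1, hdec⟩ :=
    exists_geometric_decay (w := w) r hμ hβ hsLo hsHi hη hηβ
  -- The first summand turns the residual bound into δ ≤ Cρᵗ; the second makes the risk at most
  -- s_+²(Cρᵗ)², so c₂ need not depend on K.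
  set C := √(K / σ) + √K / sHi with hCdef
  have hC : 0 < C := by positivity
  have hC1 : K ≤ σ * C ^ 2 := by
    have h1 : √(K / σ) ≤ C := le_add_of_nonneg_right (by positivity)
    have h2 := pow_le_pow_left₀ (Real.sqrt_nonneg _) h1 2
    rwa [Real.sq_sqrt (by positivity), div_le_iff₀ hσ, mul_comm] at h2
  have hC2 : K ≤ sHi ^ 2 * C ^ 2 := by
    have h1 : √K / sHi ≤ C := le_add_of_nonneg_left (by positivity)
    have h2 := pow_le_pow_left₀ (by positivity) h1 2
    rwa [div_pow, Real.sq_sqrt hK.le, div_le_iff₀ (by positivity), mul_comm] at h2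
  obtain ⟨T, hTO, hT⟩ := exists_geometric_round hC hρ hρ1
  refine ⟨C, ρ, T, hC, hρ, hρ1, hTO, ?_⟩
  intro N d m Ω _ P _ E hE hAS hW hb hc _
  have hres : ∀ᵐ ω ∂P, ∀ t n,
      frobSq (E.W n * E.X ω n - E.B ω t n * E.A ω t n * E.X ω n) ≤ K * (ρ ^ t) ^ 2 := by
    filter_upwards [hb, hc] with ω hbω hcω t n
    exact hdec d m (E.Astar n) (E.Bstar n) (E.X ω n) (fun t => E.M ω t n) (fun t => E.A ω t n)
      (fun t => E.B ω t n) (hcω.rank_pos hsLo n) (hW n) (hcω.scale_lower n) (hcω.scale_upper n)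
      (fun t => hAS ω t n) (fun t => hbω.lower_A t n) (fun t => hbω.upper_A t n)
      (fun t => hbω.lower_B t n) (fun t => hbω.upper_B t n) t
  have hdelta : ∀ᵐ ω ∂P, ∀ t n, E.delta ω t n ≤ C * ρ ^ t := by
    filter_upwards [hb, hc, hres] with ω hbω hcω hr t n
    have h1 := misalignment_sq_mul_le hσ.le (le_vecMul_X hβ hsLo hbω hcω n) (E.W n) (E.A ω t n)
      (E.B ω t n)
    have h2 : σ * E.delta ω t n ^ 2 ≤ σ * (C * ρ ^ t) ^ 2 :=
      h1.trans ((hr t n).trans (by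
        rw [mul_pow, ← mul_assoc]; exact mul_le_mul_of_nonneg_right hC1 (sq_nonneg _)))
    exact (abs_le_of_sq_le_sq' (le_of_mul_le_mul_left h2 hσ) (by positivity)).2
  have hriskAS : ∀ t, ∀ᵐ ω ∂P, E.riskAS t ω ≤ K * (ρ ^ t) ^ 2 := fun t =>
    hres.mono fun ω h => average_le (by positivity) (h t)
  have hintAS : ∀ t, Integrable (E.riskAS t) P := fun t =>
    integrable_of_measurable_of_le (hE.riskAS hAS t).aestronglyMeasurable
      (fun ω => riskAS_nonneg t) (hriskAS t)
  have hERAS : ∀ t, ∫ ω, E.riskAS t ω ∂P ≤ K * (ρ ^ t) ^ 2 := fun t =>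
    (integral_mono_ae (hintAS t) (integrable_const _) (hriskAS t)).trans (by simp)
  have hintFFA : ∀ t, Integrable (E.riskFFA η t) P := fun t =>
    integrable_of_measurable_of_le (hE.riskFFA η t).aestronglyMeasurable
      (fun ω => riskFFA_nonneg t) (by
        filter_upwards [hb, hc] with ω hbω hcω
        exact (antitone_riskFFA hη hβ hηβ hbω t.zero_le).trans
          (riskFFA_zero_le hβ hsLo hW hbω hcω))
  have hintδ := integrable_delta_sq hμ hsLo hsHi hE hW hb hc
  have hintavg : Integrable (fun ω => 1 / (N : ℝ) * ∑ n, E.delta ω 0 n ^ 2) P :=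
    (integrable_finsetSum _ fun n _ => hintδ n).const_mul _
  have havg : ∫ ω, 1 / (N : ℝ) * ∑ n, E.delta ω 0 n ^ 2 ∂P =
      1 / (N : ℝ) * ∑ n, ∫ ω, E.delta ω 0 n ^ 2 ∂P := by
    rw [integral_const_mul, integral_finsetSum _ fun n _ => hintδ n]
  have hlow : ∀ t, σ * (1 / (N : ℝ) * ∑ n, ∫ ω, E.delta ω 0 n ^ 2 ∂P) ≤
      ∫ ω, E.riskFFA η t ω ∂P := by
    intro t
    rw [← havg, ← integral_const_mul]
    refine integral_mono_ae (hintavg.const_mul _) (hintFFA t) ?_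
    filter_upwards [hb, hc] with ω hbω hcω
    exact le_riskFFA hμ hβ hsLo hbω hcω t
  have hanti : Antitone fun t => ∫ ω, E.riskFFA η t ω ∂P := fun s t hst =>
    integral_mono_ae (hintFFA t) (hintFFA s) (hb.mono fun ω hbω =>
      antitone_riskFFA hη hβ hηβ hbω hst)
  have hlim := tendsto_atTop_ciInf hanti
    ⟨0, by rintro _ ⟨t, rfl⟩; exact integral_nonneg fun ω => riskFFA_nonneg t⟩
  -- The FFA risk decreases and is nonnegative, so its limit is the infimum.
  set RFFA := ⨅ t, ∫ ω, E.riskFFA η t ω ∂P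
  have hRlow := ge_of_tendsto' hlim hlow
  refine ⟨hdelta, ?_, hintAS, hintFFA, hintδ, 0, RFFA, ?_, hlim, fun ε hε => by positivity,
    hRlow, ?_, ?_⟩
  · intro ε hε t ht
    have hCt := hT ε hε t ht
    refine ⟨hdelta.mono fun ω h n => (h t n).trans hCt, (hERAS t).trans ?_⟩
    calc K * (ρ ^ t) ^ 2 ≤ sHi ^ 2 * C ^ 2 * (ρ ^ t) ^ 2 :=
          mul_le_mul_of_nonneg_right hC2 (sq_nonneg _)
      _ = sHi ^ 2 * (C * ρ ^ t) ^ 2 := by ring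
      _ ≤ sHi ^ 2 * ε ^ 2 := by gcongr
  · have h0 : Tendsto (fun t : ℕ => K * (ρ ^ t) ^ 2) atTop (𝓝 0) := by
      simpa using ((tendsto_pow_atTop_nhds_zero_of_lt_one hρ.le hρ1).pow 2).const_mul K
    exact tendsto_of_tendsto_of_tendsto_of_le_of_le tendsto_const_nhds h0
      (fun t => integral_nonneg fun ω => riskAS_nonneg t) hERAS
  · rcases N.eq_zero_or_pos with rfl | hN
    · refine le_of_tendsto' hlim fun t => ?_
      simp [riskFFA]
    set L := 2 * (sHi ^ 2 * (r * w ^ 2) + β * (β / sLo ^ 2 * r))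
    have hq : |1 - η * μ| < 1 := by
      -- A single sample point and a single layer suffice to get μ ≤ β, hence 0 ≤ 1 - ημ < 1.
      obtain ⟨ω, hbω, hcω⟩ := (hb.and hc).exists
      have hμβ := le_of_hess_bounds (hcω.rank_pos hsLo ⟨0, hN⟩) (hcω.dim_pos hsLo ⟨0, hN⟩)
        (hbω.lower_B 0 ⟨0, hN⟩) (hbω.upper_B 0 ⟨0, hN⟩)
      have hηβ1 : η * β ≤ 1 := by rwa [le_div_iff₀ hβ] at hηβ
      have := mul_pos hη hμ
      rw [abs_lt]
      constructor <;> nlinarith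
    have hup : ∀ t, ∫ ω, E.riskFFA η t ω ∂P ≤
        sHi ^ 2 * (1 / (N : ℝ) * ∑ n, ∫ ω, E.delta ω 0 n ^ 2 ∂P) + |1 - η * μ| ^ t * L := by
      intro t
      have h1 : ∫ ω, E.riskFFA η t ω ∂P ≤
          ∫ ω, (sHi ^ 2 * (1 / (N : ℝ) * ∑ n, E.delta ω 0 n ^ 2) + |1 - η * μ| ^ t * L) ∂P := by
        refine integral_mono_ae (hintFFA t)
          ((hintavg.const_mul _).add (integrable_const _)) ?_
        filter_upwards [hb, hc] with ω hbω hcω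
        exact riskFFA_le hη hμ hβ hηβ hsLo hW hbω hcω t
      rwa [integral_add (hintavg.const_mul _) (integrable_const _), integral_const_mul, havg,
        integral_const, probReal_univ, one_smul] at h1
    have h0 : Tendsto (fun t : ℕ => sHi ^ 2 * (1 / (N : ℝ) * ∑ n, ∫ ω, E.delta ω 0 n ^ 2 ∂P) +
        |1 - η * μ| ^ t * L) atTop
        (𝓝 (sHi ^ 2 * (1 / (N : ℝ) * ∑ n, ∫ ω, E.delta ω 0 n ^ 2 ∂P))) := by
      simpa using ((tendsto_pow_atTop_nhds_zero_of_lt_one (abs_nonneg _) hq).mul_const L).const_add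
        (sHi ^ 2 * (1 / (N : ℝ) * ∑ n, ∫ ω, E.delta ω 0 n ^ 2 ∂P))
    exact le_of_tendsto_of_tendsto' hlim h0 hup
  · rintro ε hε ⟨n₀, hn₀⟩
    have hN : (0 : ℝ) < N := Nat.cast_pos.2 n₀.pos
    -- The support of δ⁰² contains the event δ⁰ > ε, so the lower bound on R_FFA is positive while
    -- R_AS = 0.
    have hpos : 0 < ∫ ω, E.delta ω 0 n₀ ^ 2 ∂P := by
      refine (integral_pos_iff_support_of_nonneg (fun ω => sq_nonneg _) (hintδ n₀)).2
        (hn₀.trans_le (measure_mono fun ω hω => ?_))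
      have : 0 < E.delta ω 0 n₀ := hε.trans hω
      exact (pow_pos this 2).ne'
    have hsum : ∫ ω, E.delta ω 0 n₀ ^ 2 ∂P ≤ ∑ n, ∫ ω, E.delta ω 0 n ^ 2 ∂P :=
      Finset.single_le_sum (f := fun n => ∫ ω, E.delta ω 0 n ^ 2 ∂P)
        (fun n _ => integral_nonneg fun ω => sq_nonneg _) (Finset.mem_univ n₀)
    exact lt_of_lt_of_le (mul_pos hσ (mul_pos (by positivity) (hpos.trans_le hsum))) hRlow
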